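/- **Conventions.** Let $d\ge 0$. A *labeled Delone set* is the graph of a map $\ell:\Lambda\to X$ from a uniformly discrete and relatively dense set $\Lambda\subset\mathbb R^d$ to a compact metric space $X$. A *labeled tiling* is the graph of a map to $X$ from a set of tiles (convex polytopes with nonempty interior, belonging up to translation to a set of polytopes that is compact for the Hausdorff distance) that cover $\mathbb R^d$ and pairwise intersect only on their boundaries. $T\cap B(x,R)$ denotes the set of labeled points of $T$ in $B(x,R)$, respectively of labeled tiles of $T$ meeting $B(x,R)$. $T$ and $T'$ are $\varepsilon$-close if a one-to-one correspondence between some of their labeled points (tiles), including all those in (meeting) $B(0,1/\varepsilon)$, moves points (tiles, in Hausdorff distance) and labels by less than $\varepsilon$; this defines the topology. A *tiling space* $\Omega$ is the closure of the set of all translates $T-x$ ($x\in\mathbb R^d$) of a labeled Delone set or labeled tiling $T$; all tiling spaces are assumed minimal (every translation orbit is dense) and aperiodic ($T-x=T$ with $T\in\Omega$ only for $x=0$). $\Omega$ is *FLC* if, for each $R>0$, only finitely many patches $T\cap B(x,R)$, $T\in\Omega$, $x\in\mathbb R^d$, occur up to translation. An *orbit equivalence* $h:\Omega\to\Omega'$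 is a homeomorphism that sends $\mathbb R^d$-orbits onto $\mathbb R^d$-orbits. A *topological conjugacy* is a homeomorphism $\phi$ with $\phi(T-x)=\phi(T)-x$. A continuous map $f:\Omega\to\Omega'$ is *local* if for all $r>0$ there is $R>0$ such that $T\cap B(0,R)=T'\cap B(0,R)$ implies $f(T)\cap B(0,r)=f(T')\cap B(0,r)$. An *MLD map* is a topological conjugacy $\phi$ such that $\phi$ and $\phi^{-1}$ are local. A *weak cocycle* is a continuous $\alpha:\Omega\times\mathbb R^d\to\mathbb R^d$ with $\alpha(T,v)+\alpha(T-v,w)=\alpha(T,v+w)$. A continuous $s:\Omega\to\mathbb R^d$ has the coboundary $\delta s(T,v)=s(T-v)-s(T)$, and is *strongly pattern-equivariant* if for some $R>0$ the value $s(T)$ depends only on $T\cap B(0,R)$. A *strong cocycle* is a weak cocycle for which $T\mapsto\alpha(T,v)$ is strongly pattern-equivariant for every $v$. $H^1_w(\Omega;\mathbb R^d)$ is the group of weak cocycles modulo coboundaries of continuous functions, and $H^1_s(\Omega;\mathbb R^d)$ the group of strong cocycles modulo coboundaries of strongly pattern-equivariant functions. The cocycle of a map $h$ that sends orbits into orbits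 is $(T,x)\mapsto h_T(x)$, where $h(T-x)=h(T)-h_T(x)$. For an orbit equivalence $h$ it is a weak cocycle, and $[h]\in H^1_w(\Omega;\mathbb R^d)$ is its class. If $\Omega,\Omega'$ are FLC, then $[h]\in H^1_s(\Omega;\mathbb R^d)$ is the class of the cocycle of $h_s:T\mapsto h(T)-s(T)$, where $s:\Omega\to\mathbb R^d$ is any continuous function such that $h_s$ is a local map (such $s$ exist, the cocycle of $h_s$ is strong, and its class does not depend on $s$). **Theorem.** Let $h_1:\Omega\to\Omega_1$ and $h_2:\Omega\to\Omega_2$ be orbit equivalences between minimal aperiodic tiling spaces of $\mathbb R^d$. 1. If $[h_1]=[h_2]$ in $H^1_w(\Omega;\mathbb R^d)$, then there are a continuous $s:\Omega\to\mathbb R^d$ such that $\tau_s:\Omega\to\Omega$, $T\mapsto T-s(T)$, is a homeomorphism, and a topological conjugacy $\phi:\Omega_1\to\Omega_2$ such that $h_2\circ\tau_s=\phi\circ h_1$. 2. If $\Omega,\Omega_1,\Omega_2$ are FLC and $[h_1]=[h_2]$ in $H^1_s(\Omega;\mathbb R^d)$, then the same conclusion holds with $\phi$ an MLD map. -/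

import Mathlib

open Set Filter Topology TopologicalSpace Metric

noncomputable section

namespace TilingClassification

/-- The space `ℝ^d` with its Euclidean norm. -/
abbrev E (d : ℕ) : Type := EuclideanSpace ℝ (Fin d)

/-- A labeled tile: a nonempty compact subset of `ℝ^d` with a label. A labeled point `(x, l)` of a
Delone set is the labeled tile `({x}, l)`. The distance is the maximum of the Hausdorff distance
and of the distance between the labels; on labeled points it is `max ‖x - y‖ (dist l m)`. -/
abbrev Tile (d : ℕ) (X : Type*) : Type _ := NonemptyCompacts (E d) × X

/-- The translate `t - x` of a labeled tile. -/
def Tile.shift {d : ℕ} {X : Type*} (x : E d) (t : Tile d X) : Tile d X :=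
  (t.1.map (fun y => y - x) (continuous_id.sub continuous_const), t.2)

/-- A set of labeled tiles. Labeled tilings and labeled Delone sets are patterns. -/
@[ext]
structure Pattern (d : ℕ) (X : Type*) where
  tiles : Set (Tile d X)

namespace Pattern

variable {d : ℕ} {X : Type*}

/-- The translate `T - x`. -/
def shift (T : Pattern d X) (x : E d) : Pattern d X := ⟨Tile.shift x '' T.tiles⟩

/-- The patch `T ∩ B(x, R)`: the labeled tiles of `T` that meet the ball `B(x, R)`; for a Delone
set, the labeled points that lie in `B(x, R)`. -/
def patch (T : Pattern d X) (x : E d) (R : ℝ) : Pattern d X :=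
  ⟨{t ∈ T.tiles | ((t.1 : Set (E d)) ∩ ball x R).Nonempty}⟩

/-- The translation orbit of `T`. -/
def orbit (T : Pattern d X) : Set (Pattern d X) := range T.shift

/-- `T` is a labeled Delone set: the graph of a map from a Delone set to `X`. -/
def IsDelone (T : Pattern d X) : Prop :=
  ∃ (D : Delone.DeloneSet (E d)) (l : D.carrier → X),
    T.tiles = range fun x : D.carrier => (({(x : E d)} : NonemptyCompacts (E d)), l x)

/-- A tile shape: a convex polytope with nonempty interior. -/
def IsPolytope (t : NonemptyCompacts (E d)) : Prop :=
  (∃ F : Finset (E d), (t : Set (E d)) = convexHull ℝ (F : Set (E d))) ∧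
    (interior (t : Set (E d))).Nonempty

/-- `T` is a labeled tiling: up to translation its tiles belong to a compact set of polytopes,
they cover `ℝ^d`, and two distinct ones only intersect on their boundary. (In particular no tile
carries two labels.) -/
def IsTiling (T : Pattern d X) : Prop :=
  (∃ A : Set (NonemptyCompacts (E d)), IsCompact A ∧ (∀ a ∈ A, IsPolytope a) ∧
    ∀ t ∈ T.tiles, ∃ a ∈ A, ∃ x : E d, (t.1 : Set (E d)) = (fun y => y + x) '' (a : Set (E d))) ∧
  (⋃ t ∈ T.tiles, (t.1 : Set (E d))) = univ ∧
  ∀ t ∈ T.tiles, ∀ u ∈ T.tiles, t ≠ u →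
    (t.1 : Set (E d)) ∩ u.1 ⊆ frontier (t.1 : Set (E d)) ∩ frontier (u.1 : Set (E d))

/-- A family of patterns has finite local complexity: for each `R`, up to translation, only finitely
many patches of radius `R` occur in its members. -/
def HasFLC (S : Set (Pattern d X)) : Prop :=
  ∀ R : ℝ, 0 < R → ∃ F : Set (Pattern d X), F.Finite ∧
    ∀ T ∈ S, ∀ x : E d, ∃ P ∈ F, ∃ y : E d, T.patch x R = P.shift y

section Topology

variable [MetricSpace X]

/-- `T` and `T'` are `ε`-close: there is a one-to-one correspondence `M` between part of the tiles
of `T` and part of the tiles of `T'` such that corresponding tiles are at distance `< ε`, and such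
that all tiles of `T` and of `T'` that meet the ball `B(0, 1/ε)` take part in it. -/
def Close (ε : ℝ) (T T' : Pattern d X) : Prop :=
  ∃ M : Tile d X → Tile d X → Prop,
    (∀ t u, M t u → t ∈ T.tiles ∧ u ∈ T'.tiles ∧ dist t u < ε) ∧
    (∀ t u t' u', M t u → M t' u' → (t = t' ↔ u = u')) ∧
    (∀ t ∈ (T.patch 0 ε⁻¹).tiles, ∃ u, M t u) ∧
    (∀ u ∈ (T'.patch 0 ε⁻¹).tiles, ∃ t, M t u)

theorem Close.mono {ε δ : ℝ} (hε : 0 < ε) (h : ε ≤ δ) {T T' : Pattern d X} (H : Close ε T T') :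
    Close δ T T' := by
  obtain ⟨M, h1, h2, h3, h4⟩ := H
  have hb : ball (0 : E d) δ⁻¹ ⊆ ball 0 ε⁻¹ := ball_subset_ball (inv_anti₀ hε h)
  refine ⟨M, fun t u m => ?_, h2, fun t ht => h3 t ⟨ht.1, ht.2.mono (inter_subset_inter_right _ hb)⟩,
    fun t ht => h4 t ⟨ht.1, ht.2.mono (inter_subset_inter_right _ hb)⟩⟩
  obtain ⟨a, b, c⟩ := h1 t u m
  exact ⟨a, b, c.trans_le h⟩

theorem Close.refl {ε : ℝ} (hε : 0 < ε) (T : Pattern d X) : Close ε T T :=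
  ⟨fun t u => t ∈ T.tiles ∧ t = u,
    fun t u h => ⟨h.1, h.2 ▸ h.1, by rw [h.2, dist_self]; exact hε⟩,
    fun t u t' u' h h' => by rw [← h.2, ← h'.2],
    fun t ht => ⟨t, ht.1, rfl⟩, fun t ht => ⟨t, ht.1, rfl⟩⟩

theorem Close.symm {ε : ℝ} {T T' : Pattern d X} (H : Close ε T T') : Close ε T' T := by
  obtain ⟨M, h1, h2, h3, h4⟩ := H
  refine ⟨fun t u => M u t, fun t u m => ?_, fun t u t' u' m m' => (h2 _ _ _ _ m m').symm, h4, h3⟩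
  obtain ⟨a, b, c⟩ := h1 u t m
  exact ⟨b, a, by rwa [dist_comm]⟩

/-- A tile within `δ` of a tile that meets `B(0, r)` meets `B(0, r + δ)`. -/
theorem meets_of_dist_lt {t u : Tile d X} {r δ : ℝ} (h : dist t u < δ)
    (ht : ((t.1 : Set (E d)) ∩ ball 0 r).Nonempty) :
    ((u.1 : Set (E d)) ∩ ball 0 (r + δ)).Nonempty := by
  obtain ⟨y, hy, hyr⟩ := ht
  have h' : hausdorffDist (t.1 : Set (E d)) (u.1 : Set (E d)) < δ :=
    lt_of_le_of_lt (by rw [← NonemptyCompacts.dist_eq]; exact le_max_left _ _) h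
  obtain ⟨z, hz, hyz⟩ := exists_dist_lt_of_hausdorffDist_lt hy h'
    (hausdorffEDist_ne_top_of_nonempty_of_bounded t.1.nonempty u.1.nonempty
      t.1.isCompact.isBounded u.1.isCompact.isBounded)
  refine ⟨z, hz, ?_⟩
  rw [mem_ball] at hyr ⊢
  linarith [dist_triangle_left z 0 y]

theorem Close.trans {ε δ : ℝ} (hδ : 0 < δ) (h1 : δ ≤ ε / 2) (h2 : δ ≤ ε⁻¹)
    {T T' T'' : Pattern d X} (H : Close δ T T') (H' : Close δ T' T'') : Close ε T T'' := by
  have hε : 0 < ε := by linarith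
  have hr : ε⁻¹ + δ ≤ δ⁻¹ := by
    have : (ε / 2)⁻¹ ≤ δ⁻¹ := inv_anti₀ hδ h1
    have h3 : (ε / 2)⁻¹ = 2 * ε⁻¹ := by field_simp
    linarith
  have hb : ball (0 : E d) ε⁻¹ ⊆ ball 0 δ⁻¹ := ball_subset_ball (by linarith)
  have hb' : ball (0 : E d) (ε⁻¹ + δ) ⊆ ball 0 δ⁻¹ := ball_subset_ball hr
  obtain ⟨M, a1, a2, a3, a4⟩ := H
  obtain ⟨N, b1, b2, b3, b4⟩ := H'
  refine ⟨fun t v => ∃ u, M t u ∧ N u v, ?_, ?_, ?_, ?_⟩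
  · rintro t v ⟨u, m, n⟩
    obtain ⟨p1, p2, p3⟩ := a1 _ _ m
    obtain ⟨q1, q2, q3⟩ := b1 _ _ n
    exact ⟨p1, q2, by linarith [dist_triangle t u v]⟩
  · rintro t v t' v' ⟨u, m, n⟩ ⟨u', m', n'⟩
    rw [a2 _ _ _ _ m m', b2 _ _ _ _ n n']
  · rintro t ⟨ht, hm⟩
    obtain ⟨u, m⟩ := a3 t ⟨ht, hm.mono (inter_subset_inter_right _ hb)⟩
    obtain ⟨p1, p2, p3⟩ := a1 _ _ m
    obtain ⟨v, n⟩ := b3 u ⟨p2, (meets_of_dist_lt p3 hm).mono (inter_subset_inter_right _ hb')⟩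
    exact ⟨v, u, m, n⟩
  · rintro v ⟨hv, hm⟩
    obtain ⟨u, n⟩ := b4 v ⟨hv, hm.mono (inter_subset_inter_right _ hb)⟩
    obtain ⟨p1, p2, p3⟩ := b1 _ _ n
    rw [dist_comm] at p3
    obtain ⟨t, m⟩ := a4 u ⟨p1, (meets_of_dist_lt p3 hm).mono (inter_subset_inter_right _ hb')⟩
    exact ⟨t, u, m, n⟩

/-- The entourages `{(T, T') | T and T' are ε-close}` for `ε > 0`. -/
def closeBasis (d : ℕ) (X : Type*) [MetricSpace X] : FilterBasis (Pattern d X × Pattern d X) where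
  sets := {U | ∃ ε : ℝ, 0 < ε ∧ U = {p | Close ε p.1 p.2}}
  nonempty := ⟨_, 1, one_pos, rfl⟩
  inter_sets := by
    rintro _ _ ⟨ε, hε, rfl⟩ ⟨δ, hδ, rfl⟩
    exact ⟨_, ⟨min ε δ, lt_min hε hδ, rfl⟩, fun p hp =>
      ⟨Close.mono (lt_min hε hδ) (min_le_left _ _) hp,
        Close.mono (lt_min hε hδ) (min_le_right _ _) hp⟩⟩

/-- The topology on patterns: a neighborhood basis of `T` is given by the sets of all patterns
`ε`-close to `T`, for `ε > 0`. -/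
instance instUniformSpace : UniformSpace (Pattern d X) :=
  UniformSpace.ofCore <| UniformSpace.Core.mkOfBasis (closeBasis d X)
    (by rintro _ ⟨ε, hε, rfl⟩ T; exact Close.refl hε T)
    (by rintro _ ⟨ε, hε, rfl⟩; exact ⟨_, ⟨ε, hε, rfl⟩, fun p hp => Close.symm hp⟩)
    (by
      rintro _ ⟨ε, hε, rfl⟩
      have hδ : 0 < min (ε / 2) ε⁻¹ := lt_min (by linarith) (inv_pos.2 hε)
      refine ⟨_, ⟨min (ε / 2) ε⁻¹, hδ, rfl⟩, ?_⟩
      rintro ⟨T, T''⟩ ⟨T', h, h'⟩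
      exact Close.trans hδ (min_le_left _ _) (min_le_right _ _) h h')

theorem uniformity_hasBasis :
    (uniformity (Pattern d X)).HasBasis (fun ε : ℝ => 0 < ε) fun ε => {p | Close ε p.1 p.2} := by
  refine ⟨fun U => ?_⟩
  have : U ∈ uniformity (Pattern d X) ↔ ∃ V ∈ closeBasis d X, V ⊆ U :=
    (closeBasis d X).mem_filter_iff
  rw [this]
  constructor
  · rintro ⟨_, ⟨ε, hε, rfl⟩, h⟩
    exact ⟨ε, hε, h⟩
  · rintro ⟨ε, hε, h⟩
    exact ⟨_, ⟨ε, hε, rfl⟩, h⟩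

theorem dist_shift (x : E d) (t u : Tile d X) : dist (t.shift x) (u.shift x) = dist t u := by
  have : dist (t.shift x).1 (u.shift x).1 = dist t.1 u.1 := by
    rw [NonemptyCompacts.dist_eq, NonemptyCompacts.dist_eq]
    simp only [Tile.shift, NonemptyCompacts.coe_map]
    exact hausdorffDist_image (Isometry.of_dist_eq fun a b => dist_sub_right a b x)
  rw [Prod.dist_eq, Prod.dist_eq, this]
  rfl

theorem shift_injective (x : E d) : Function.Injective (Tile.shift (X := X) x) := fun t u h => by
  rw [← dist_eq_zero, ← dist_shift x, h, dist_self]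

theorem continuous_shift (x : E d) : Continuous fun T : Pattern d X => T.shift x := by
  refine UniformContinuous.continuous ?_
  refine (uniformity_hasBasis.uniformContinuous_iff uniformity_hasBasis).2 fun ε hε => ?_
  have hpos : 0 < ε⁻¹ + ‖x‖ := by positivity
  have hδ : 0 < min ε (ε⁻¹ + ‖x‖)⁻¹ := lt_min hε (inv_pos.2 hpos)
  have hr : ε⁻¹ + ‖x‖ ≤ (min ε (ε⁻¹ + ‖x‖)⁻¹)⁻¹ := by
    rw [le_inv_comm₀ hpos hδ]; exact min_le_right _ _
  have key : ∀ t : Tile d X, (((t.shift x).1 : Set (E d)) ∩ ball 0 ε⁻¹).Nonempty →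
      ((t.1 : Set (E d)) ∩ ball 0 (min ε (ε⁻¹ + ‖x‖)⁻¹)⁻¹).Nonempty := by
    rintro t ⟨_, ⟨y, hy, rfl⟩, h⟩
    refine ⟨y, hy, ?_⟩
    rw [mem_ball_zero_iff] at h ⊢
    have : ‖y‖ ≤ ‖y - x‖ + ‖x‖ := by simpa using norm_add_le (y - x) x
    simp only at h
    linarith
  refine ⟨_, hδ, ?_⟩
  rintro T T' ⟨M, h1, h2, h3, h4⟩
  refine ⟨fun t u => ∃ t₀ u₀, M t₀ u₀ ∧ t₀.shift x = t ∧ u₀.shift x = u, ?_, ?_, ?_, ?_⟩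
  · rintro _ _ ⟨t, u, m, rfl, rfl⟩
    obtain ⟨a, b, c⟩ := h1 _ _ m
    exact ⟨⟨t, a, rfl⟩, ⟨u, b, rfl⟩, by rw [dist_shift]; exact c.trans_le (min_le_left _ _)⟩
  · rintro _ _ _ _ ⟨t, u, m, rfl, rfl⟩ ⟨t', u', m', rfl, rfl⟩
    rw [(shift_injective x).eq_iff, (shift_injective x).eq_iff]
    exact h2 _ _ _ _ m m'
  · rintro _ ⟨⟨t, ht, rfl⟩, hm⟩
    obtain ⟨u, m⟩ := h3 t ⟨ht, key t hm⟩
    exact ⟨_, t, u, m, rfl, rfl⟩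
  · rintro _ ⟨⟨u, hu, rfl⟩, hm⟩
    obtain ⟨t, m⟩ := h4 u ⟨hu, key u hm⟩
    exact ⟨_, t, u, m, rfl, rfl⟩

end Topology

theorem shift_shift (T : Pattern d X) (x y : E d) : (T.shift x).shift y = T.shift (x + y) := by
  ext1
  simp only [shift, image_image]
  refine image_congr fun t _ => Prod.ext (NonemptyCompacts.ext ?_) rfl
  simp only [Tile.shift, NonemptyCompacts.coe_map, image_image, sub_sub]

end Pattern

/-- A minimal aperiodic tiling space of `ℝ^d` with labels in `X`: the hull of a labeled Delone set
or of a labeled tiling, in which all orbits are dense and no element has a nonzero period. -/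
structure TilingSpace (d : ℕ) (X : Type*) [MetricSpace X] where
  carrier : Set (Pattern d X)
  is_hull : ∃ T : Pattern d X, (T.IsDelone ∨ T.IsTiling) ∧ carrier = closure T.orbit
  minimal : ∀ T ∈ carrier, carrier ⊆ closure T.orbit
  aperiodic : ∀ T ∈ carrier, ∀ x : E d, T.shift x = T → x = 0

instance {d : ℕ} {X : Type*} [MetricSpace X] : CoeSort (TilingSpace d X) (Type _) where
  coe Ω := Ω.carrier

section

variable {d : ℕ} {X X' : Type*} [MetricSpace X] [MetricSpace X']

theorem TilingSpace.shift_mem (Ω : TilingSpace d X) {T : Pattern d X} (hT : T ∈ Ω.carrier)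
    (x : E d) : T.shift x ∈ Ω.carrier := by
  obtain ⟨T₀, -, h⟩ := Ω.is_hull
  rw [h] at hT ⊢
  refine map_mem_closure (f := fun S : Pattern d X => S.shift x) (Pattern.continuous_shift x) hT ?_
  rintro _ ⟨y, rfl⟩
  exact ⟨y + x, (Pattern.shift_shift T₀ y x).symm⟩

/-- The translate `T - x` of an element of a tiling space. -/
def tmove {Ω : TilingSpace d X} (T : Ω) (x : E d) : Ω := ⟨T.1.shift x, Ω.shift_mem T.2 x⟩

/-- The translation orbit of `T` in a tiling space. -/
def orb {Ω : TilingSpace d X} (T : Ω) : Set Ω := range (tmove T)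

/-- `T` and `T'` have the same patch of radius `R` around the origin. -/
def SamePatch {Ω : TilingSpace d X} (R : ℝ) (T T' : Ω) : Prop :=
  T.1.patch 0 R = T'.1.patch 0 R

/-- The tiling space has finite local complexity. -/
def TilingSpace.FLC (Ω : TilingSpace d X) : Prop := Pattern.HasFLC Ω.carrier

/-! ### Maps between tiling spaces -/

/-- The homeomorphism `h` sends orbits to orbits. -/
def IsOrbitEquivalence {Ω : TilingSpace d X} {Ω' : TilingSpace d X'} (h : Ω ≃ₜ Ω') : Prop :=
  ∀ T, h '' orb T = orb (h T)

/-- The homeomorphism `φ` commutes with translations. -/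
def IsConjugacy {Ω : TilingSpace d X} {Ω' : TilingSpace d X'} (φ : Ω ≃ₜ Ω') : Prop :=
  ∀ T x, φ (tmove T x) = tmove (φ T) x

/-- Local maps. -/
def IsLocalMap {Ω : TilingSpace d X} {Ω' : TilingSpace d X'} (f : Ω → Ω') : Prop :=
  Continuous f ∧ ∀ r : ℝ, 0 < r → ∃ R : ℝ, 0 < R ∧
    ∀ T T' : Ω, SamePatch R T T' → SamePatch r (f T) (f T')

/-- Mutual local derivations: conjugacies that are local together with their inverse. -/
def IsMLD {Ω : TilingSpace d X} {Ω' : TilingSpace d X'} (φ : Ω ≃ₜ Ω') : Prop :=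
  IsConjugacy φ ∧ IsLocalMap φ ∧ IsLocalMap φ.symm

/-! ### Weak and strong cohomology -/

/-- The coboundary `δs (T, v) = s(T - v) - s(T)`. -/
def coboundary {Ω : TilingSpace d X} (s : Ω → E d) : Ω → E d → E d :=
  fun T v => s (tmove T v) - s T

/-- Strongly pattern-equivariant functions on `Ω`: continuous functions whose value at `T` depends
only on a patch of fixed radius of `T` around the origin. -/
def IsStronglyPE {Ω : TilingSpace d X} (s : Ω → E d) : Prop :=
  Continuous s ∧ ∃ R : ℝ, 0 < R ∧ ∀ T T' : Ω, SamePatch R T T' → s T = s T'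

theorem SamePatch.mono {Ω : TilingSpace d X} {R R' : ℝ} (h : R ≤ R') {T T' : Ω}
    (H : SamePatch R' T T') : SamePatch R T T' := by
  have key : ∀ S : Pattern d X, S.patch 0 R = (S.patch 0 R').patch 0 R := fun S => by
    ext t
    exact ⟨fun ht => ⟨⟨ht.1, ht.2.mono (inter_subset_inter_right _ (ball_subset_ball h))⟩, ht.2⟩,
      fun ht => ⟨ht.1.1, ht.2⟩⟩
  unfold SamePatch at *
  rw [key, H, ← key]

theorem IsStronglyPE.add {Ω : TilingSpace d X} {s t : Ω → E d} (hs : IsStronglyPE s)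
    (ht : IsStronglyPE t) : IsStronglyPE (s + t) := by
  obtain ⟨cs, R, hR, h⟩ := hs
  obtain ⟨ct, R', hR', h'⟩ := ht
  refine ⟨cs.add ct, max R R', lt_max_of_lt_left hR, fun T T' H => ?_⟩
  simp only [Pi.add_apply, h T T' (H.mono (le_max_left _ _)), h' T T' (H.mono (le_max_right _ _))]

theorem IsStronglyPE.zero {Ω : TilingSpace d X} : IsStronglyPE (0 : Ω → E d) :=
  ⟨continuous_const, 1, one_pos, fun _ _ _ => rfl⟩

theorem IsStronglyPE.smul {Ω : TilingSpace d X} (c : ℝ) {s : Ω → E d} (hs : IsStronglyPE s) :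
    IsStronglyPE (c • s) := by
  obtain ⟨cs, R, hR, h⟩ := hs
  exact ⟨cs.const_smul c, R, hR, fun T T' H => by simp only [Pi.smul_apply, h T T' H]⟩

/-- Weak dynamical 1-cocycles: continuous maps `α : Ω × ℝ^d → ℝ^d` with
`α(T, v) + α(T - v, w) = α(T, v + w)`. -/
def weakCocycles (Ω : TilingSpace d X) : Submodule ℝ (Ω → E d → E d) where
  carrier := {α | Continuous (fun p : Ω × E d => α p.1 p.2) ∧
    ∀ T v w, α T v + α (tmove T v) w = α T (v + w)}
  add_mem' := fun {α β} hα hβ => ⟨hα.1.add hβ.1, fun T v w => by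
    simp only [Pi.add_apply, ← hα.2, ← hβ.2]; abel⟩
  zero_mem' := ⟨continuous_const, fun T v w => by simp⟩
  smul_mem' := fun c α hα => ⟨hα.1.const_smul c, fun T v w => by
    simp only [Pi.smul_apply, ← hα.2, smul_add]⟩

/-- Weak 1-coboundaries: coboundaries of continuous functions. -/
def weakCoboundaries (Ω : TilingSpace d X) : Submodule ℝ (Ω → E d → E d) where
  carrier := {α | ∃ s : Ω → E d, Continuous s ∧ α = coboundary s}
  add_mem' := by
    rintro _ _ ⟨s, hs, rfl⟩ ⟨t, ht, rfl⟩
    exact ⟨s + t, hs.add ht, by funext T v; simp only [coboundary, Pi.add_apply]; abel⟩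
  zero_mem' := ⟨0, continuous_const, by funext T v; simp [coboundary]⟩
  smul_mem' := by
    rintro c _ ⟨s, hs, rfl⟩
    exact ⟨c • s, hs.const_smul c, by funext T v; simp [coboundary, smul_sub]⟩

/-- Strong dynamical 1-cocycles: those for which every `T ↦ α(T, v)` is strongly
pattern-equivariant. -/
def strongCocycles (Ω : TilingSpace d X) : Submodule ℝ (Ω → E d → E d) where
  carrier := {α | α ∈ weakCocycles Ω ∧ ∀ v, IsStronglyPE fun T => α T v}
  add_mem' := fun hα hβ => ⟨add_mem hα.1 hβ.1, fun v => (hα.2 v).add (hβ.2 v)⟩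
  zero_mem' := ⟨zero_mem _, fun _ => IsStronglyPE.zero⟩
  smul_mem' := fun c _ hα => ⟨Submodule.smul_mem _ c hα.1, fun v => (hα.2 v).smul c⟩

/-- Strong 1-coboundaries: coboundaries of strongly pattern-equivariant functions. -/
def strongCoboundaries (Ω : TilingSpace d X) : Submodule ℝ (Ω → E d → E d) where
  carrier := {α | ∃ s : Ω → E d, IsStronglyPE s ∧ α = coboundary s}
  add_mem' := by
    rintro _ _ ⟨s, hs, rfl⟩ ⟨t, ht, rfl⟩
    exact ⟨s + t, hs.add ht, by funext T v; simp only [coboundary, Pi.add_apply]; abel⟩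
  zero_mem' := ⟨0, IsStronglyPE.zero, by funext T v; simp [coboundary]⟩
  smul_mem' := by
    rintro c _ ⟨s, hs, rfl⟩
    exact ⟨c • s, hs.smul c, by funext T v; simp [coboundary, smul_sub]⟩

/-- The weak cohomology group `H^1_w(Ω; ℝ^d)`. -/
abbrev WeakH1 (Ω : TilingSpace d X) : Type _ :=
  weakCocycles Ω ⧸ (weakCoboundaries Ω).submoduleOf (weakCocycles Ω)

/-- The strong cohomology group `H^1_s(Ω; ℝ^d)`. -/
abbrev StrongH1 (Ω : TilingSpace d X) : Type _ :=
  strongCocycles Ω ⧸ (strongCoboundaries Ω).submoduleOf (strongCocycles Ω)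

/-! ### The classes of an orbit equivalence -/

/-- `α` is the cocycle `(T, v) ↦ f_T(v)` of the map `f`: `f(T - v) = f(T) - α(T, v)`. By
aperiodicity `f` has at most one such `α`. -/
def IsCocycleOf {Ω : TilingSpace d X} {Ω' : TilingSpace d X'} (f : Ω → Ω')
    (α : Ω → E d → E d) : Prop :=
  ∀ T v, f (tmove T v) = tmove (f T) (α T v)

open Classical in
/-- The weak class `[h] ∈ H^1_w(Ω; ℝ^d)`: the class of the cocycle of `h`. For an orbit equivalence
this cocycle exists, is unique and is continuous (the value `0` is only for other maps). -/
def weakClass {Ω : TilingSpace d X} {Ω' : TilingSpace d X'} (h : Ω → Ω') : WeakH1 Ω :=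
  if H : ∃ α : weakCocycles Ω, IsCocycleOf h α then Submodule.Quotient.mk H.choose else 0

/-- `α` is a strong cocycle of a perturbation of `h`: there is a continuous `s : Ω → ℝ^d` such that
`h_s : T ↦ h(T) - s(T)` is a local map (equivalently, maps transversals into transversals) and `α`
is the cocycle of `h_s`. -/
def IsStrongRepresentative {Ω : TilingSpace d X} {Ω' : TilingSpace d X'} (h : Ω → Ω')
    (α : strongCocycles Ω) : Prop :=
  ∃ s : Ω → E d, Continuous s ∧ IsLocalMap (fun T => tmove (h T) (s T)) ∧
    IsCocycleOf (fun T => tmove (h T) (s T)) α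

open Classical in
/-- The strong class `[h] ∈ H^1_s(Ω; ℝ^d)` of a homeomorphism `h` of FLC tiling spaces: the class of
the cocycle of a perturbation `h_s` of `h` that is a local map. For FLC spaces such a perturbation
exists and the class does not depend on it (the value `0` is only for other maps or spaces). -/
def strongClass {Ω : TilingSpace d X} {Ω' : TilingSpace d X'} (h : Ω → Ω') : StrongH1 Ω :=
  if H : ∃ α : strongCocycles Ω, IsStrongRepresentative h α
  then Submodule.Quotient.mk H.choose else 0

end

end TilingClassification

end

/-!
An equality of classes means that suitable perturbations `f₁ = h₁ - s₁` and `f₂ = h₂ - s₂` have the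
same cocycle; then so do `h₁` and `f = f₂ + s₁`, that is `f (T - v) = f T - α (T, v)` with `α` the
cocycle of `h₁`. Since each `α (T, ·)` is a bijection of `ℝ^d`, the map `f` is injective on each
orbit and sends it onto an orbit; it keeps orbits apart because `h₂` does, and its image is compact
and contains a dense orbit. Hence `f` is a homeomorphism, `φ = f ∘ h₁⁻¹` commutes with translations,
and `h₂⁻¹ ∘ f` moves `T` along its orbit by a vector that is continuous in `T`.

Continuity of cocycles rests on Sierpiński's theorem. Given `a > 0`, two vectors that lead from `S`
to sufficiently close tilings differ by less than `a` or by more than `2 * a`. So when `S - g y`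
depends continuously on `y`, the values of `g` locally split into countably many clusters with
closed fibers, and in a locally connected space these fibers are open.

For FLC spaces, nearby tilings agree on a large patch up to a small translation. Averaging these
translations with a partition of unity that depends on patches gives a perturbation of an orbit
equivalence whose central patch is determined by a patch. Its cocycle is then determined by patches,
because a small translation vector is determined by the patches at its two ends, and this carries
the local dependence to every radius. A conjugacy between two such local perturbations is local:
if `h T` and `S'` share a large patch then, by FLC for `Ω`, `S'` can be moved slightly so that its
preimage shares a large patch with `T`.
-/

namespace TilingClassification

/-! ### Hausdorff distance and convex bodies -/

theorem exists_dist_lt_of_dist_lt {α : Type*} [MetricSpace α] {a b : NonemptyCompacts α} {δ : ℝ}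
    (h : dist a b < δ) {x : α} (hx : x ∈ a) : ∃ y ∈ b, dist x y < δ :=
  exists_dist_lt_of_hausdorffDist_lt hx (by rwa [← NonemptyCompacts.dist_eq])
    (hausdorffEDist_ne_top_of_nonempty_of_bounded a.nonempty b.nonempty
      a.isCompact.isBounded b.isCompact.isBounded)

section NormedSpace

variable {V : Type*} [NormedAddCommGroup V] [NormedSpace ℝ V] {s : Set V}

/- The lower bound compares the suprema of a norming functional of `y - x` on the two translates. -/
theorem hausdorffDist_image_sub_right (hs : Bornology.IsBounded s) (hne : s.Nonempty) (x y : V) :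
    hausdorffDist ((· - x) '' s) ((· - y) '' s) = dist x y := by
  refine le_antisymm (hausdorffDist_le_of_mem_dist dist_nonneg ?_ ?_) ?_
  · rintro _ ⟨z, hz, rfl⟩
    exact ⟨z - y, ⟨z, hz, rfl⟩, (dist_sub_left z x y).le⟩
  · rintro _ ⟨z, hz, rfl⟩
    exact ⟨z - x, ⟨z, hz, rfl⟩, (dist_sub_left z y x).trans (dist_comm y x) |>.le⟩
  have hsub : ∀ v, LipschitzWith 1 fun z : V => z - v := fun v =>
    LipschitzWith.mk_one fun a b => (dist_sub_right a b v).le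
  have htop : hausdorffEDist ((· - x) '' s) ((· - y) '' s) ≠ ⊤ :=
    hausdorffEDist_ne_top_of_nonempty_of_bounded (hne.image _) (hne.image _)
      ((hsub x).isBounded_image hs) ((hsub y).isBounded_image hs)
  obtain ⟨f, hf, hfxy⟩ := exists_dual_vector'' ℝ (y - x)
  have hbdd : BddAbove (f '' s) := (f.lipschitz.isBounded_image hs).bddAbove
  refine le_of_forall_pos_le_add fun ε hε => ?_
  obtain ⟨_, ⟨z, hz, rfl⟩, hzε⟩ :=
    exists_lt_of_lt_csSup (hne.image f) (sub_lt_self (sSup (f '' s)) (half_pos hε))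
  obtain ⟨_, ⟨w, hw, rfl⟩, hzw⟩ := exists_dist_lt_of_hausdorffDist_lt (mem_image_of_mem _ hz)
    (lt_add_of_pos_right _ (half_pos hε)) htop
  have hle : f (z - x - (w - y)) ≤ dist (z - x) (w - y) :=
    (le_abs_self _).trans ((f.le_of_opNorm_le hf _).trans (by rw [one_mul, dist_eq_norm]))
  have hsplit : f (z - x - (w - y)) = f z - f w + dist x y := by
    rw [dist_comm, dist_eq_norm, show z - x - (w - y) = z - w + (y - x) by abel, map_add, map_sub,
      hfxy]
    rfl
  linarith [le_csSup hbdd (mem_image_of_mem f hw)]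

/- A hyperplane that strictly separates `x ∉ s` from `s` would, pushed by `δ` in the direction of
its normal, still separate a point of `ball x δ` from the thickening. -/
theorem ball_subset_of_ball_add_subset_thickening (hs : Convex ℝ s) (hcl : IsClosed s) {c : V}
    {ρ δ : ℝ} (hδ : 0 < δ) (h : ball c (ρ + δ) ⊆ thickening δ s) : ball c ρ ⊆ s := by
  intro x hx
  by_contra hxs
  obtain ⟨f, u, hfs, hfx⟩ := geometric_hahn_banach_closed_point hs hcl hxs
  have hle : ∀ n : V, ‖n‖ ≤ 1 → f n ≤ ‖f‖ - (f x - u) / δ := by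
    intro n hn
    have hδn : ‖δ • n‖ ≤ δ := by
      rw [norm_smul, Real.norm_of_nonneg hδ.le]
      exact mul_le_of_le_one_right hδ.le hn
    have hmem : x + δ • n ∈ ball c (ρ + δ) := by
      rw [mem_ball, dist_eq_norm, add_sub_right_comm]
      rw [mem_ball, dist_eq_norm] at hx
      linarith [norm_add_le (x - c) (δ • n)]
    obtain ⟨w, hw, hxw⟩ := mem_thickening_iff.1 (h hmem)
    have hfw : f (x + δ • n - w) ≤ ‖f‖ * δ := by
      rw [dist_eq_norm] at hxw
      exact (le_abs_self _).trans ((f.le_opNorm _).trans (by gcongr))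
    rw [map_sub, map_add, map_smul, smul_eq_mul] at hfw
    rw [le_sub_iff_add_le, ← le_sub_iff_add_le', div_le_iff₀ hδ]
    linarith [hfs w hw]
  have hnorm : ‖f‖ ≤ ‖f‖ - (f x - u) / δ := by
    refine f.opNorm_le_of_unit_norm (by simpa using hle 0 (by simp)) fun n hn => abs_le.2 ⟨?_, ?_⟩
    · linarith [hle (-n) (by rw [norm_neg, hn]), map_neg f n]
    · exact hle n hn.le
  have hgap : 0 < (f x - u) / δ := div_pos (sub_pos.2 hfx) hδ
  linarith

theorem ball_subset_of_dist_lt {a b : NonemptyCompacts V} {c : V} {ρ δ : ℝ}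
    (ha : ball c (ρ + δ) ⊆ (a : Set V)) (hb : Convex ℝ (b : Set V)) (hab : dist a b < δ) :
    ball c ρ ⊆ (b : Set V) :=
  ball_subset_of_ball_add_subset_thickening hb b.isCompact.isClosed (dist_nonneg.trans_lt hab)
    fun _ hx => mem_thickening_iff.2 (exists_dist_lt_of_dist_lt hab (ha hx))

theorem exists_forall_ball_subset_of_isCompact {A : Set (NonemptyCompacts V)} (hA : IsCompact A)
    (hconv : ∀ a ∈ A, Convex ℝ (a : Set V)) (hint : ∀ a ∈ A, (interior (a : Set V)).Nonempty) :
    ∃ ρ > 0, ∀ a ∈ A, ∃ c, ball c ρ ⊆ (a : Set V) := by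
  suffices ∃ ρ > 0, ∀ a ∈ A, a ∈ A → ∃ c, ball c ρ ⊆ (a : Set V) by
    obtain ⟨ρ, hρ, h⟩ := this
    exact ⟨ρ, hρ, fun a ha => h a ha ha⟩
  refine hA.induction_on (p := fun B => ∃ ρ > 0, ∀ a ∈ B, a ∈ A → ∃ c, ball c ρ ⊆ (a : Set V))
    ⟨1, one_pos, by simp⟩ ?_ ?_ ?_
  · rintro B C hBC ⟨ρ, hρ, h⟩
    exact ⟨ρ, hρ, fun a ha => h a (hBC ha)⟩
  · rintro B C ⟨ρ, hρ, h⟩ ⟨ρ', hρ', h'⟩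
    refine ⟨min ρ ρ', lt_min hρ hρ', ?_⟩
    rintro a (ha | ha) haA
    · exact (h a ha haA).imp fun c => (ball_subset_ball (min_le_left _ _)).trans
    · exact (h' a ha haA).imp fun c => (ball_subset_ball (min_le_right _ _)).trans
  · intro a ha
    obtain ⟨c, hc⟩ := hint a ha
    obtain ⟨ε, hε, hball⟩ := Metric.isOpen_iff.1 isOpen_interior c hc
    refine ⟨ball a (ε / 2), mem_nhdsWithin_of_mem_nhds (ball_mem_nhds a (half_pos hε)), ε / 2,
      half_pos hε, fun b hb hbA => ⟨c, ?_⟩⟩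
    exact ball_subset_of_dist_lt (δ := ε / 2)
      (by rw [add_halves]; exact hball.trans interior_subset)
      (hconv b hbA) (mem_ball'.1 hb)

end NormedSpace

theorem finite_of_totallyBounded_of_pairwise {α : Type*} [PseudoMetricSpace α] {s : Set α} {r : ℝ}
    (hr : 0 < r) (hs : TotallyBounded s) (hsep : s.Pairwise fun x y => r ≤ dist x y) :
    s.Finite := by
  obtain ⟨F, -, hF, hcov⟩ := hs.exists_subset (dist_mem_uniformity (half_pos hr))
  choose! c hcF hc using fun x (hx : x ∈ s) => mem_iUnion₂.1 (hcov hx)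
  simp only [mem_ofPred_eq] at hc
  refine Finite.of_finite_image (hF.subset (image_subset_iff.2 hcF)) fun x hx y hy hxy => ?_
  by_contra hne
  have hyc := hc y hy
  rw [← hxy] at hyc
  linarith [dist_triangle_right x y (c x), hsep hx hy hne, hc x hx]

/-! ### Translations of tiles and patterns -/

namespace Tile

variable {d : ℕ} {X : Type*}

theorem mem_shift {x y : E d} {t : Tile d X} : y ∈ (Tile.shift x t).1 ↔ y + x ∈ t.1 := by
  rw [← SetLike.mem_coe, Tile.shift, NonemptyCompacts.coe_map, ← SetLike.mem_coe, mem_image]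
  exact ⟨fun ⟨z, hz, hzy⟩ => by rwa [← hzy, sub_add_cancel],
    fun h => ⟨y + x, h, add_sub_cancel_right y x⟩⟩

theorem shift_shift (x y : E d) (t : Tile d X) :
    Tile.shift y (Tile.shift x t) = Tile.shift (x + y) t := by
  refine Prod.ext (NonemptyCompacts.ext (Set.ext fun z => ?_)) rfl
  simp only [SetLike.mem_coe, mem_shift, add_assoc, add_comm y x]

theorem shift_zero (t : Tile d X) : Tile.shift 0 t = t := by
  refine Prod.ext (NonemptyCompacts.ext (Set.ext fun z => ?_)) rfl
  simp only [SetLike.mem_coe, mem_shift, add_zero]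

theorem nonempty_shift_inter_ball {x c : E d} {R : ℝ} {t : Tile d X} :
    (((Tile.shift x t).1 : Set (E d)) ∩ ball c R).Nonempty ↔
      ((t.1 : Set (E d)) ∩ ball (c + x) R).Nonempty := by
  constructor
  · rintro ⟨y, hy, hyR⟩
    exact ⟨y + x, mem_shift.1 hy, by rwa [mem_ball, dist_add_right]⟩
  · rintro ⟨y, hy, hyR⟩
    refine ⟨y - x, mem_shift.2 (by rwa [sub_add_cancel]), ?_⟩
    rwa [mem_ball, ← dist_add_right _ _ x, sub_add_cancel]

theorem dist_shift_fst (x y : E d) (t : Tile d X) :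
    dist (Tile.shift x t).1 (Tile.shift y t).1 = dist x y :=
  hausdorffDist_image_sub_right t.1.isCompact.isBounded t.1.nonempty x y

theorem shift_left_injective (t : Tile d X) : Function.Injective fun x => Tile.shift x t :=
  fun x y h => dist_eq_zero.1 <| (dist_shift_fst x y t).symm.trans <|
    dist_eq_zero.2 (congrArg Prod.fst h)

variable [MetricSpace X]

theorem dist_fst_le (t u : Tile d X) : dist t.1 u.1 ≤ dist t u := le_max_left _ _

theorem dist_shift_left (x y : E d) (t : Tile d X) :
    dist (Tile.shift x t) (Tile.shift y t) = dist x y := by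
  rw [Prod.dist_eq, dist_shift_fst]
  exact max_eq_left (dist_self t.2 ▸ dist_nonneg)

end Tile

namespace Pattern

variable {d : ℕ} {X : Type*}

theorem mem_shift {T : Pattern d X} {x : E d} {t : Tile d X} :
    t ∈ (T.shift x).tiles ↔ Tile.shift (-x) t ∈ T.tiles := by
  constructor
  · rintro ⟨u, hu, rfl⟩
    rwa [Tile.shift_shift, add_neg_cancel, Tile.shift_zero]
  · intro h
    exact ⟨_, h, by rw [Tile.shift_shift, neg_add_cancel, Tile.shift_zero]⟩

theorem shift_mem_shift {T : Pattern d X} {x : E d} {t : Tile d X} :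
    Tile.shift x t ∈ (T.shift x).tiles ↔ t ∈ T.tiles := by
  rw [mem_shift, Tile.shift_shift, add_neg_cancel, Tile.shift_zero]

theorem shift_zero (T : Pattern d X) : T.shift 0 = T := by
  ext t
  rw [mem_shift, neg_zero, Tile.shift_zero]

theorem patch_shift (T : Pattern d X) (x c : E d) (R : ℝ) :
    (T.shift x).patch c R = (T.patch (c + x) R).shift x := by
  ext t
  obtain ⟨u, rfl⟩ : ∃ u, Tile.shift x u = t :=
    ⟨Tile.shift (-x) t, by rw [Tile.shift_shift, neg_add_cancel, Tile.shift_zero]⟩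
  rw [shift_mem_shift]
  simp only [patch, mem_ofPred_eq, Tile.nonempty_shift_inter_ball, shift_mem_shift]

section

variable [MetricSpace X]

theorem close_shift_shift {ε : ℝ} {x y : E d} (h : dist x y < ε) (T : Pattern d X) :
    Close ε (T.shift x) (T.shift y) := by
  refine ⟨fun t u => ∃ t₀ ∈ T.tiles, Tile.shift x t₀ = t ∧ Tile.shift y t₀ = u, ?_, ?_, ?_, ?_⟩
  · rintro _ _ ⟨t, ht, rfl, rfl⟩
    exact ⟨⟨t, ht, rfl⟩, ⟨t, ht, rfl⟩, (Tile.dist_shift_left x y t).trans_lt h⟩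
  · rintro _ _ _ _ ⟨t, -, rfl, rfl⟩ ⟨t', -, rfl, rfl⟩
    rw [(shift_injective x).eq_iff, (shift_injective y).eq_iff]
  · rintro _ ⟨⟨t, ht, rfl⟩, -⟩
    exact ⟨_, t, ht, rfl, rfl⟩
  · rintro _ ⟨⟨t, ht, rfl⟩, -⟩
    exact ⟨_, t, ht, rfl, rfl⟩

theorem hasBasis_nhds (T : Pattern d X) :
    (𝓝 T).HasBasis (fun ε : ℝ => 0 < ε) fun ε => {T' | Close ε T T'} :=
  nhds_basis_uniformity' uniformity_hasBasis

theorem continuous_shift_uncurry : Continuous fun p : Pattern d X × E d => p.1.shift p.2 := by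
  rw [continuous_iff_continuousAt]
  rintro ⟨T, x⟩
  rw [ContinuousAt, Uniform.tendsto_nhds_right, tendsto_def]
  intro U hU
  obtain ⟨V, hV, hVU⟩ := comp_mem_uniformity_sets hU
  obtain ⟨ε, hε, hεV⟩ := uniformity_hasBasis.mem_iff.1 hV
  have hT : ∀ᶠ p : Pattern d X × E d in 𝓝 (T, x), (T.shift x, p.1.shift x) ∈ V :=
    (continuous_fst.tendsto (T, x)).eventually
      (Uniform.tendsto_nhds_right.1 ((continuous_shift x).tendsto T) hV)
  have hx : ∀ᶠ p : Pattern d X × E d in 𝓝 (T, x), dist x p.2 < ε := by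
    filter_upwards [(continuous_snd.tendsto (T, x)).eventually (ball_mem_nhds x hε)] with p hp
    exact mem_ball'.1 hp
  filter_upwards [hT, hx] with p hpT hpx
  exact hVU ⟨_, hpT, hεV (close_shift_shift hpx p.1)⟩

end

/-! ### Patterns of uniformly separated tiles of bounded size -/

/-- Distinct tiles have shapes at Hausdorff distance at least `r`, and tiles have diameter at most
`D`. This is the part of uniform discreteness that is common to Delone sets and tilings: it passes
to limits and makes spaces of patterns Hausdorff and, if the label space is compact, compact. -/
structure IsRegular (r D : ℝ) (T : Pattern d X) : Prop where
  separated : T.tiles.Pairwise fun t u => r ≤ dist t.1 u.1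
  bounded : ∀ t ∈ T.tiles, ∀ x ∈ t.1, ∀ y ∈ t.1, dist x y ≤ D

variable {r D : ℝ} {T L : Pattern d X}

theorem IsRegular.patch_subset (hT : T.IsRegular r D) (R : ℝ) :
    (T.patch 0 R).tiles ⊆ {t : Tile d X | (t.1 : Set (E d)) ⊆ closedBall 0 (R + D)} := by
  rintro t ⟨ht, y, hy, hyR⟩ z hz
  rw [mem_ball] at hyR
  rw [mem_closedBall]
  linarith [dist_triangle z y 0, hT.bounded t ht z hz y hy]

theorem IsRegular.finite_patch (hr : 0 < r) (hT : T.IsRegular r D) (R : ℝ) :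
    (T.patch 0 R).tiles.Finite := by
  have hinj : InjOn Prod.fst (T.patch 0 R).tiles := fun t ht u hu htu => by
    by_contra hne
    exact hr.not_ge ((hT.separated ht.1 hu.1 hne).trans_eq (dist_eq_zero.2 htu))
  refine Finite.of_finite_image (finite_of_totallyBounded_of_pairwise hr ?_ ?_) hinj
  · refine (NonemptyCompacts.isCompact_subsets_of_isCompact
      (isCompact_closedBall 0 (R + D))).totallyBounded.subset ?_
    rintro _ ⟨t, ht, rfl⟩
    exact hT.patch_subset R ht
  · rintro _ ⟨t, ht, rfl⟩ _ ⟨u, hu, rfl⟩ hne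
    exact hT.separated ht.1 hu.1 fun htu => hne (htu ▸ rfl)

theorem IsRegular.shift (hT : T.IsRegular r D) (x : E d) : (T.shift x).IsRegular r D := by
  constructor
  · rintro _ ⟨t, ht, rfl⟩ _ ⟨u, hu, rfl⟩ hne
    have hdist : dist (Tile.shift x t).1 (Tile.shift x u).1 = dist t.1 u.1 :=
      hausdorffDist_image (Isometry.of_dist_eq fun a b => dist_sub_right a b x)
    rw [hdist]
    exact hT.separated ht hu fun h => hne (h ▸ rfl)
  · rintro _ ⟨t, ht, rfl⟩ y hy z hz
    rw [← dist_add_right y z x]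
    exact hT.bounded t ht _ (Tile.mem_shift.1 hy) _ (Tile.mem_shift.1 hz)

variable [MetricSpace X]

theorem IsRegular.eq_of_dist_lt (hT : T.IsRegular r D) {t u : Tile d X} (ht : t ∈ T.tiles)
    (hu : u ∈ T.tiles) (h : dist t u < r) : t = u := by
  by_contra hne
  linarith [hT.separated ht hu hne, Tile.dist_fst_le t u]

theorem IsRegular.isClosed_tiles (hr : 0 < r) (hT : T.IsRegular r D) : IsClosed T.tiles :=
  isClosed_of_pairwise_le_dist hr fun t ht u hu hne =>
    (hT.separated ht hu hne).trans (Tile.dist_fst_le t u)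

theorem eventually_mem_thickening {t : Tile d X} (ht : t ∈ T.tiles) {ε : ℝ} (hε : 0 < ε) :
    ∀ᶠ T' : Pattern d X in 𝓝 T, t ∈ thickening ε T'.tiles := by
  obtain ⟨y, hy⟩ := t.1.nonempty
  have hpos : 0 < ‖y‖ + 1 := by positivity
  have hδ : 0 < min ε (‖y‖ + 1)⁻¹ := lt_min hε (inv_pos.2 hpos)
  filter_upwards [(hasBasis_nhds T).mem_of_mem hδ]
  rintro T' ⟨M, hM, -, hMt, -⟩
  have hle : ‖y‖ + 1 ≤ (min ε (‖y‖ + 1)⁻¹)⁻¹ := (le_inv_comm₀ hpos hδ).2 (min_le_right _ _)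
  obtain ⟨u, hu⟩ := hMt t ⟨ht, y, hy, by rw [mem_ball_zero_iff]; linarith⟩
  obtain ⟨-, hu', hdist⟩ := hM t u hu
  exact mem_thickening_iff.2 ⟨u, hu', hdist.trans_le (min_le_left _ _)⟩

theorem IsRegular.of_frequently {𝓕 : Filter (Pattern d X)}
    (h𝓕 : ∃ᶠ T in 𝓕, T.IsRegular r D)
    (hL : ∀ t ∈ L.tiles, ∀ ε > 0, ∀ᶠ T in 𝓕, t ∈ thickening ε T.tiles) : L.IsRegular r D := by
  constructor
  · intro t ht u hu hne
    refine le_of_forall_pos_le_add fun ε hε => ?_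
    have htu : 0 < dist t u := dist_pos.2 hne
    obtain ⟨δ, hδ, hδε, hδtu⟩ : ∃ δ > 0, δ ≤ ε / 2 ∧ δ ≤ dist t u / 2 :=
      ⟨min (ε / 2) (dist t u / 2), by positivity, min_le_left _ _, min_le_right _ _⟩
    obtain ⟨T, hT, htT, huT⟩ := (h𝓕.and_eventually ((hL t ht δ hδ).and (hL u hu δ hδ))).exists
    obtain ⟨t', ht', htt'⟩ := mem_thickening_iff.1 htT
    obtain ⟨u', hu', huu'⟩ := mem_thickening_iff.1 huT
    have hne' : t' ≠ u' := by
      rintro rfl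
      linarith [dist_triangle_right t u t']
    have htri := dist_triangle4_right t'.1 u'.1 t.1 u.1
    rw [dist_comm t'.1 t.1, dist_comm u'.1 u.1] at htri
    have hsep : r ≤ dist t'.1 u'.1 := hT.separated ht' hu' hne'
    linarith [Tile.dist_fst_le t t', Tile.dist_fst_le u u']
  · intro t ht x hx y hy
    refine le_of_forall_pos_le_add fun ε hε => ?_
    obtain ⟨T, hT, htT⟩ := (h𝓕.and_eventually (hL t ht (ε / 2) (half_pos hε))).exists
    obtain ⟨t', ht', htt'⟩ := mem_thickening_iff.1 htT
    have hfst := (Tile.dist_fst_le t t').trans_lt htt'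
    obtain ⟨x', hx', hxx'⟩ := exists_dist_lt_of_dist_lt hfst hx
    obtain ⟨y', hy', hyy'⟩ := exists_dist_lt_of_dist_lt hfst hy
    linarith [dist_triangle4_right x y x' y', hT.bounded t' ht' x' hx' y' hy']

theorem isClosed_setOf_isRegular (r D : ℝ) : IsClosed {T : Pattern d X | T.IsRegular r D} :=
  isClosed_of_closure_subset fun _ hT => IsRegular.of_frequently (mem_closure_iff_frequently.1 hT)
    fun _ ht _ hε => eventually_mem_thickening ht hε

theorem IsRegular.eq_of_inseparable (hr : 0 < r) (hT : T.IsRegular r D) (hL : L.IsRegular r D)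
    (h : Inseparable T L) : T = L := by
  have hsub : ∀ {T L : Pattern d X}, L.IsRegular r D → Inseparable T L → T.tiles ⊆ L.tiles := by
    intro T L hL h t ht
    rw [← (hL.isClosed_tiles hr).closure_eq, closure_eq_iInter_thickening]
    refine mem_iInter₂.2 fun ε hε => ?_
    have hev := eventually_mem_thickening ht hε
    rw [h.nhds_eq] at hev
    exact hev.self_of_nhds
  exact Pattern.ext ((hsub hL h).antisymm (hsub hT h.symm))

end Pattern

namespace Pattern

variable {d : ℕ} {X : Type*} [MetricSpace X] {r D : ℝ} {T L : Pattern d X}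

theorem IsRegular.close_of_subset_thickening (hT : T.IsRegular r D) (hL : L.IsRegular r D) {ε : ℝ}
    (hε : ε ≤ r / 2) (h : (T.patch 0 ε⁻¹).tiles ⊆ thickening ε L.tiles)
    (h' : (L.patch 0 ε⁻¹).tiles ⊆ thickening ε T.tiles) : Close ε T L := by
  refine ⟨fun t u => t ∈ T.tiles ∧ u ∈ L.tiles ∧ dist t u < ε, fun _ _ m => m, ?_, ?_, ?_⟩
  · rintro t u t' u' ⟨ht, hu, htu⟩ ⟨ht', hu', htu'⟩
    constructor
    · rintro rfl
      exact hL.eq_of_dist_lt hu hu' (by linarith [dist_triangle_left u u' t])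
    · rintro rfl
      exact hT.eq_of_dist_lt ht ht' (by linarith [dist_triangle_right t t' u])
  · intro t ht
    obtain ⟨u, hu, htu⟩ := mem_thickening_iff.1 (h ht)
    exact ⟨u, ht.1, hu, htu⟩
  · intro u hu
    obtain ⟨t, ht, hut⟩ := mem_thickening_iff.1 (h' hu)
    exact ⟨t, ht, hu.1, by rwa [dist_comm]⟩

/-- The limit of a family of patterns along an ultrafilter: the tiles that are approximated
arbitrarily well by tiles of almost all members. It is used to show that spaces of regular patterns
are compact. -/
def ultralimit (𝓕 : Ultrafilter (Pattern d X)) : Pattern d X :=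
  ⟨{t | ∀ ε > 0, ∀ᶠ T : Pattern d X in 𝓕, t ∈ thickening ε T.tiles}⟩

variable {𝓕 : Ultrafilter (Pattern d X)}

theorem isRegular_ultralimit (h𝓕 : ∀ᶠ T : Pattern d X in 𝓕, T.IsRegular r D) :
    (ultralimit 𝓕).IsRegular r D :=
  IsRegular.of_frequently h𝓕.frequently fun _ ht => ht

theorem eventually_patch_ultralimit_subset_thickening (hr : 0 < r)
    (h𝓕 : ∀ᶠ T : Pattern d X in 𝓕, T.IsRegular r D) (R : ℝ) {ε : ℝ} (hε : 0 < ε) :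
    ∀ᶠ T : Pattern d X in 𝓕, ((ultralimit 𝓕).patch 0 R).tiles ⊆ thickening ε T.tiles :=
  ((isRegular_ultralimit h𝓕).finite_patch hr R).eventually_all.2 fun _ ht => ht.1 ε hε

theorem eventually_patch_subset_thickening_ultralimit [CompactSpace X]
    (h𝓕 : ∀ᶠ T : Pattern d X in 𝓕, T.IsRegular r D) (R : ℝ) {ε : ℝ} (hε : 0 < ε) :
    ∀ᶠ T : Pattern d X in 𝓕, (T.patch 0 R).tiles ⊆ thickening ε (ultralimit 𝓕).tiles := by
  by_contra hnot
  have hbad : ∀ᶠ T : Pattern d X in 𝓕,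
      ∃ t ∈ (T.patch 0 R).tiles, t ∉ thickening ε (ultralimit 𝓕).tiles := by
    simpa only [not_subset] using Ultrafilter.eventually_not.2 hnot
  obtain ⟨c, hc⟩ := hbad.choice
  have hK : IsCompact ({a : NonemptyCompacts (E d) | (a : Set (E d)) ⊆ closedBall 0 (R + D)} ×ˢ
      (univ : Set X)) :=
    (NonemptyCompacts.isCompact_subsets_of_isCompact (isCompact_closedBall _ _)).prod isCompact_univ
  obtain ⟨t, -, ht⟩ := hK.ultrafilter_le_nhds' (𝓕.map c) <| by
    refine Ultrafilter.mem_map.2 ?_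
    filter_upwards [h𝓕, hc] with T hT hcT
    exact ⟨hT.patch_subset R hcT.1, mem_univ _⟩
  have htendsto : ∀ δ > 0, ∀ᶠ T : Pattern d X in 𝓕, dist t (c T) < δ := fun δ hδ => by
    filter_upwards [ht (ball_mem_nhds t hδ)] with T hT
    exact mem_ball'.1 hT
  have htL : t ∈ (ultralimit 𝓕).tiles := fun δ hδ => by
    filter_upwards [hc, htendsto δ hδ] with T hcT htT
    exact mem_thickening_iff.2 ⟨c T, hcT.1.1, htT⟩
  obtain ⟨T, hcT, htT⟩ := (hc.and (htendsto ε hε)).exists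
  exact hcT.2 (mem_thickening_iff.2 ⟨t, htL, by rwa [dist_comm]⟩)

theorem isCompact_setOf_isRegular [CompactSpace X] (hr : 0 < r) (D : ℝ) :
    IsCompact {T : Pattern d X | T.IsRegular r D} := by
  rw [isCompact_iff_ultrafilter_le_nhds']
  intro 𝓕 h𝓕
  have hL := isRegular_ultralimit h𝓕
  refine ⟨ultralimit 𝓕, hL, (hasBasis_nhds _).ge_iff.2 fun ε hε => ?_⟩
  have hδ : 0 < min ε (r / 2) := lt_min hε (half_pos hr)
  filter_upwards [h𝓕, eventually_patch_ultralimit_subset_thickening hr h𝓕 _ hδ,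
    eventually_patch_subset_thickening_ultralimit h𝓕 _ hδ] with T hT hLT hTL
  exact (hL.close_of_subset_thickening hT (min_le_right _ _) hLT hTL).mono hδ (min_le_left _ _)

end Pattern

/-! ### Regularity of Delone sets and tilings -/

namespace Pattern

variable {d : ℕ} {X : Type*} {T : Pattern d X}

theorem IsPolytope.convex {a : NonemptyCompacts (E d)} (ha : IsPolytope a) :
    Convex ℝ (a : Set (E d)) := by
  obtain ⟨⟨F, hF⟩, -⟩ := ha
  exact hF ▸ convex_convexHull ℝ _

theorem IsTiling.exists_separated (hT : T.IsTiling) :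
    ∃ r > 0, T.tiles.Pairwise fun t u => r ≤ dist t.1 u.1 := by
  obtain ⟨⟨A, hA, hpoly, hTA⟩, -, hdisj⟩ := hT
  obtain ⟨r, hr, hball⟩ := exists_forall_ball_subset_of_isCompact hA
    (fun a ha => (hpoly a ha).convex) fun a ha => (hpoly a ha).2
  refine ⟨r, hr, fun t ht u hu hne => ?_⟩
  by_contra! hlt
  obtain ⟨c, hc⟩ : ∃ c, ball c r ⊆ (t.1 : Set (E d)) := by
    obtain ⟨a, ha, x, hx⟩ := hTA t ht
    obtain ⟨c, hc⟩ := hball a ha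
    refine ⟨c + x, fun y hy => hx ▸ ⟨y - x, hc ?_, sub_add_cancel y x⟩⟩
    rwa [mem_ball, ← dist_add_right _ _ x, sub_add_cancel]
  obtain ⟨z, hz, hcz⟩ := exists_dist_lt_of_dist_lt hlt (hc (mem_ball_self hr))
  rw [← mem_ball'] at hcz
  exact (hdisj t ht u hu hne ⟨hc hcz, hz⟩).1.2 (interior_maximal hc isOpen_ball hcz)

theorem IsTiling.exists_bounded (hT : T.IsTiling) :
    ∃ D, ∀ t ∈ T.tiles, ∀ x ∈ t.1, ∀ y ∈ t.1, dist x y ≤ D := by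
  obtain ⟨⟨A, hA, -, hTA⟩, -⟩ := hT
  obtain ⟨D, hD⟩ := isBounded_iff.1
    (NonemptyCompacts.isCompact_biUnion_coe_of_isCompact hA).isBounded
  refine ⟨D, fun t ht y hy z hz => ?_⟩
  obtain ⟨a, ha, x, hx⟩ := hTA t ht
  rw [← SetLike.mem_coe, hx] at hy hz
  obtain ⟨y, hy, rfl⟩ := hy
  obtain ⟨z, hz, rfl⟩ := hz
  rw [dist_add_right]
  exact hD (mem_biUnion ha hy) (mem_biUnion ha hz)

theorem IsTiling.exists_isRegular (hT : T.IsTiling) : ∃ r > 0, ∃ D, T.IsRegular r D := by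
  obtain ⟨r, hr, hsep⟩ := hT.exists_separated
  obtain ⟨D, hD⟩ := hT.exists_bounded
  exact ⟨r, hr, D, hsep, hD⟩

theorem IsDelone.exists_isRegular (hT : T.IsDelone) : ∃ r > 0, ∃ D, T.IsRegular r D := by
  obtain ⟨Λ, l, hΛ⟩ := hT
  refine ⟨Λ.packingRadius, Λ.packingRadius_pos, 0, ?_, ?_⟩
  · rw [hΛ]
    rintro _ ⟨x, rfl⟩ _ ⟨y, rfl⟩ hne
    have hxy : (x : E d) ≠ y := fun h => hne (by rw [Subtype.ext h])
    exact (Λ.packingRadius_lt_dist_of_mem_ne x.2 y.2 hxy).le.trans_eq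
      (NonemptyCompacts.isometry_singleton.dist_eq (x : E d) y).symm
  · rw [hΛ]
    rintro _ ⟨x, rfl⟩ y hy z hz
    rw [NonemptyCompacts.mem_singleton] at hy hz
    rw [hy, hz, dist_self]

theorem IsTiling.exists_patch_nonempty (hT : T.IsTiling) :
    ∃ ρ > 0, ∀ x, (T.patch x ρ).tiles.Nonempty := by
  refine ⟨1, one_pos, fun x => ?_⟩
  obtain ⟨t, ht, hxt⟩ := mem_iUnion₂.1 (hT.2.1 ▸ mem_univ x)
  exact ⟨t, ht, x, hxt, mem_ball_self one_pos⟩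

theorem IsDelone.exists_patch_nonempty (hT : T.IsDelone) :
    ∃ ρ > 0, ∀ x, (T.patch x ρ).tiles.Nonempty := by
  obtain ⟨Λ, l, hΛ⟩ := hT
  refine ⟨Λ.coveringRadius + 1, by positivity, fun x => ?_⟩
  obtain ⟨y, hy, hxy⟩ := Λ.exists_dist_le_coveringRadius x
  refine ⟨({y}, l ⟨y, hy⟩), hΛ ▸ ⟨⟨y, hy⟩, rfl⟩, y, (NonemptyCompacts.mem_singleton _ _).2 rfl, ?_⟩
  rw [mem_ball']
  exact hxy.trans_lt (lt_add_one _)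

end Pattern

/-! ### The dynamics of a tiling space -/

section Dynamics

variable {d : ℕ} {X : Type*} [MetricSpace X]

theorem Pattern.eventually_patch_subset_thickening (T : Pattern d X) (R : ℝ) {ε : ℝ} (hε : 0 < ε) :
    ∀ᶠ T' : Pattern d X in 𝓝 T, (T'.patch 0 R).tiles ⊆ thickening ε T.tiles := by
  have hpos : 0 < |R| + 1 := by positivity
  have hδ : 0 < min ε (|R| + 1)⁻¹ := lt_min hε (inv_pos.2 hpos)
  filter_upwards [(Pattern.hasBasis_nhds T).mem_of_mem hδ]
  rintro T' ⟨M, hM, -, -, hMu⟩ u ⟨hu, hmeets⟩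
  have hle : |R| + 1 ≤ (min ε (|R| + 1)⁻¹)⁻¹ := (le_inv_comm₀ hpos hδ).2 (min_le_right _ _)
  have hball : ball (0 : E d) R ⊆ ball 0 (min ε (|R| + 1)⁻¹)⁻¹ :=
    ball_subset_ball (by linarith [le_abs_self R])
  obtain ⟨t, ht⟩ := hMu u ⟨hu, hmeets.mono (inter_subset_inter_right _ hball)⟩
  obtain ⟨ht, -, hdist⟩ := hM t u ht
  exact mem_thickening_iff.2 ⟨t, ht, by rw [dist_comm]; exact hdist.trans_le (min_le_left _ _)⟩

namespace TilingSpace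

theorem exists_isRegular (Ω : TilingSpace d X) :
    ∃ r > 0, ∃ D, ∀ T ∈ Ω.carrier, T.IsRegular r D := by
  obtain ⟨T₀, hT₀, hΩ⟩ := Ω.is_hull
  obtain ⟨r, hr, D, hreg⟩ := hT₀.elim (fun h => h.exists_isRegular) fun h => h.exists_isRegular
  rw [hΩ]
  refine ⟨r, hr, D, closure_minimal ?_ (Pattern.isClosed_setOf_isRegular r D)⟩
  rintro _ ⟨x, rfl⟩
  exact hreg.shift x

theorem exists_patch_nonempty (Ω : TilingSpace d X) :
    ∃ ρ > 0, ∀ T ∈ Ω.carrier, (T.patch 0 ρ).tiles.Nonempty := by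
  obtain ⟨T₀, hT₀, hΩ⟩ := Ω.is_hull
  obtain ⟨ρ, hρ, hne⟩ :=
    hT₀.elim (fun h => h.exists_patch_nonempty) fun h => h.exists_patch_nonempty
  refine ⟨ρ + 1, by positivity, fun T hT => ?_⟩
  rw [hΩ, mem_closure_iff_frequently] at hT
  obtain ⟨_, ⟨x, rfl⟩, hsub⟩ :=
    (hT.and_eventually (T.eventually_patch_subset_thickening ρ one_pos)).exists
  have hpatch : ((T₀.shift x).patch 0 ρ).tiles.Nonempty := by
    rw [Pattern.patch_shift]
    exact (hne _).image _
  obtain ⟨u, hu⟩ := hpatch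
  obtain ⟨t, ht, hut⟩ := mem_thickening_iff.1 (hsub hu)
  exact ⟨t, ht, Pattern.meets_of_dist_lt hut hu.2⟩

instance instCompactSpace [CompactSpace X] (Ω : TilingSpace d X) : CompactSpace Ω := by
  obtain ⟨r, hr, D, hreg⟩ := Ω.exists_isRegular
  obtain ⟨T₀, -, hΩ⟩ := Ω.is_hull
  rw [← isCompact_iff_compactSpace]
  exact (Pattern.isCompact_setOf_isRegular hr D).of_isClosed_subset (hΩ ▸ isClosed_closure) hreg

theorem uniformity_hasBasis (Ω : TilingSpace d X) :
    (uniformity Ω).HasBasis (fun ε : ℝ => 0 < ε) fun ε => {p | Pattern.Close ε p.1.1 p.2.1} := by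
  rw [uniformity_subtype]
  exact Pattern.uniformity_hasBasis.comap _

instance instT2Space (Ω : TilingSpace d X) : T2Space Ω := by
  obtain ⟨r, hr, D, hreg⟩ := Ω.exists_isRegular
  have : T0Space Ω := ⟨fun T T' h => Subtype.ext <| (hreg T T.2).eq_of_inseparable hr
    (hreg T' T'.2) ((subtype_inseparable_iff T T').1 h)⟩
  infer_instance

end TilingSpace

variable {Ω : TilingSpace d X}

theorem tmove_zero (T : Ω) : tmove T 0 = T := Subtype.ext (Pattern.shift_zero _)

theorem tmove_tmove (T : Ω) (x y : E d) : tmove (tmove T x) y = tmove T (x + y) :=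
  Subtype.ext (Pattern.shift_shift _ _ _)

theorem tmove_injective (T : Ω) : Function.Injective (tmove T) := fun x y h => by
  have hperiod : tmove (tmove T x) (y - x) = tmove T x := by
    rw [tmove_tmove, add_sub_cancel, h]
  exact (sub_eq_zero.1 (Ω.aperiodic _ (tmove T x).2 _ (congrArg Subtype.val hperiod))).symm

@[fun_prop]
theorem continuous_tmove {Y : Type*} [TopologicalSpace Y] {f : Y → Ω} {g : Y → E d}
    (hf : Continuous f) (hg : Continuous g) : Continuous fun y => tmove (f y) (g y) :=
  Continuous.subtype_mk (Pattern.continuous_shift_uncurry.comp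
    ((continuous_subtype_val.comp hf).prodMk hg)) _

theorem dense_orb (T : Ω) : Dense (orb T) := fun T' => by
  rw [closure_subtype, orb, ← range_comp]
  exact Ω.minimal T.1 T.2 T'.2

/-! ### Equality of patches -/

theorem SamePatch.symm {R : ℝ} {T T' : Ω} (h : SamePatch R T T') : SamePatch R T' T := Eq.symm h

theorem SamePatch.trans {R : ℝ} {T T' T'' : Ω} (h : SamePatch R T T') (h' : SamePatch R T' T'') :
    SamePatch R T T'' := Eq.trans h h'

theorem samePatch_iff {R : ℝ} {T T' : Ω} :
    SamePatch R T T' ↔ ∀ t : Tile d X, ((t.1 : Set (E d)) ∩ ball 0 R).Nonempty →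
      (t ∈ T.1.tiles ↔ t ∈ T'.1.tiles) := by
  rw [SamePatch, Pattern.ext_iff, Set.ext_iff]
  exact forall_congr' fun t => and_congr_left_iff

theorem samePatch_tmove_iff {R : ℝ} {T T' : Ω} {v : E d} :
    SamePatch R (tmove T v) (tmove T' v) ↔ ∀ t : Tile d X,
      ((t.1 : Set (E d)) ∩ ball v R).Nonempty → (t ∈ T.1.tiles ↔ t ∈ T'.1.tiles) := by
  rw [samePatch_iff]
  constructor
  · intro h t ht
    rw [← Pattern.shift_mem_shift (T := T.1) (x := v),
      ← Pattern.shift_mem_shift (T := T'.1) (x := v)]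
    exact h _ (Tile.nonempty_shift_inter_ball.2 (by rwa [zero_add]))
  · intro h t ht
    refine Pattern.mem_shift.trans ((h _ ?_).trans Pattern.mem_shift.symm)
    rwa [Tile.nonempty_shift_inter_ball, add_neg_cancel]

theorem SamePatch.tmove {R R' : ℝ} {T T' : Ω} (h : SamePatch R T T') {v : E d}
    (hv : ‖v‖ + R' ≤ R) : SamePatch R' (tmove T v) (tmove T' v) := by
  rw [samePatch_iff] at h
  refine samePatch_tmove_iff.2 fun t ht => h t (ht.mono ?_)
  refine inter_subset_inter_right _ (ball_subset_ball' ?_)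
  rw [dist_zero_right]
  linarith

theorem SamePatch.of_forall_ball {r ρ : ℝ} {T T' : Ω}
    (h : ∀ p ∈ ball (0 : E d) r, ∃ v, ‖p - v‖ < ρ ∧
      SamePatch ρ (TilingClassification.tmove T v) (TilingClassification.tmove T' v)) :
    SamePatch r T T' := by
  rw [samePatch_iff]
  rintro t ⟨p, hpt, hp⟩
  obtain ⟨v, hv, hs⟩ := h p hp
  exact samePatch_tmove_iff.1 hs t ⟨p, hpt, mem_ball_iff_norm.2 hv⟩

/-- Two translates of the same pattern by vectors at distance less than `r` have distinct patches
of radius `R`: a quantitative version of the freeness of the action of small translations. -/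
def TilingSpace.IsRigid (Ω : TilingSpace d X) (r R : ℝ) : Prop :=
  ∀ (T : Ω) (x y : E d), ‖x - y‖ < r → SamePatch R (tmove T x) (tmove T y) → x = y

theorem TilingSpace.exists_isRigid (Ω : TilingSpace d X) : ∃ r > 0, ∃ R > 0, Ω.IsRigid r R := by
  obtain ⟨r, hr, D, hreg⟩ := Ω.exists_isRegular
  obtain ⟨ρ, hρ, hne⟩ := Ω.exists_patch_nonempty
  refine ⟨r, hr, ρ, hρ, fun T x y hxy hs => ?_⟩
  obtain ⟨u, hu, hm⟩ := hne _ (tmove T x).2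
  have hux : Tile.shift (-x) u ∈ T.1.tiles := Pattern.mem_shift.1 hu
  have huy : Tile.shift (-y) u ∈ T.1.tiles := Pattern.mem_shift.1 ((samePatch_iff.1 hs u hm).1 hu)
  have hdist : dist (Tile.shift (-x) u) (Tile.shift (-y) u) < r := by
    rwa [Tile.dist_shift_left, dist_neg_neg, dist_eq_norm]
  exact neg_injective
    (Tile.shift_left_injective u ((hreg T T.2).eq_of_dist_lt hux huy hdist))

theorem TilingSpace.IsRigid.eq_add {r R : ℝ} (hΩ : Ω.IsRigid r R) {S P Q : Ω} {x y z : E d}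
    (hP : SamePatch R S (tmove P x)) (hQ : SamePatch R S (tmove Q y))
    (hPQ : SamePatch (R + ‖x‖) P (tmove Q z)) (hxyz : ‖y - (z + x)‖ < r) : y = z + x := by
  have hPQx := hPQ.tmove (add_comm _ _ : ‖x‖ + R = _).le
  rw [tmove_tmove] at hPQx
  exact hΩ Q _ _ hxyz (hQ.symm.trans (hP.trans hPQx))

theorem TilingSpace.exists_samePatch_imp_mem (Ω : TilingSpace d X) {U : Set (Ω × Ω)}
    (hU : U ∈ uniformity Ω) : ∃ R > 0, ∀ T T' : Ω, SamePatch R T T' → (T, T') ∈ U := by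
  obtain ⟨ε, hε, hεU⟩ := Ω.uniformity_hasBasis.mem_iff.1 hU
  refine ⟨ε⁻¹, inv_pos.2 hε, fun T T' h => hεU
    ⟨fun t u => t ∈ (T.1.patch 0 ε⁻¹).tiles ∧ t = u, ?_, ?_, ?_, ?_⟩⟩
  · rintro t _ ⟨ht, rfl⟩
    exact ⟨ht.1, ((congrArg (t ∈ Pattern.tiles ·) h).mp ht).1, by rwa [dist_self]⟩
  · rintro t _ t' _ ⟨-, rfl⟩ ⟨-, rfl⟩
    rfl
  · exact fun t ht => ⟨t, ht, rfl⟩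
  · exact fun t ht => ⟨t, h ▸ ht, rfl⟩

end Dynamics

/-! ### Finite local complexity -/

theorem exists_eq_of_isometry_of_dist_lt {α β : Type*} [MetricSpace α] [CompleteSpace α]
    [MetricSpace β] {g : α → β} (hg : Isometry g) (y : β) {ε : ℝ} (hε : 0 < ε) :
    ∃ η > 0, ∀ w, dist y (g w) < η → ∃ w₀, g w₀ = y ∧ dist w w₀ < ε := by
  by_cases hy : y ∈ range g
  · obtain ⟨w₀, rfl⟩ := hy
    exact ⟨ε, hε, fun w hw => ⟨w₀, rfl, by rwa [dist_comm, ← hg.dist_eq]⟩⟩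
  · obtain ⟨η, hη, hball⟩ :=
      Metric.isOpen_iff.1 hg.isClosedEmbedding.isClosed_range.isOpen_compl y hy
    exact ⟨η, hη, fun w hw => absurd (mem_range_self w) (hball (mem_ball'.2 hw))⟩

section FLC

variable {d : ℕ} {X : Type*} [MetricSpace X]

theorem Tile.isometry_shift_pi {ι : Type*} [Fintype ι] [Nonempty ι] (f : ι → Tile d X) :
    Isometry fun (w : E d) i => Tile.shift w (f i) :=
  Isometry.of_dist_eq fun w w' => le_antisymm
    ((dist_pi_le_iff dist_nonneg).2 fun i => (Tile.dist_shift_left w w' (f i)).le)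
    ((Tile.dist_shift_left w w' (f (Classical.arbitrary ι))).ge.trans
      (dist_le_pi_dist (fun i => Tile.shift w (f i)) (fun i => Tile.shift w' (f i)) _))

theorem Tile.eventually_exists_shift_eq {P Q : Set (Tile d X)} (hP : P.Finite) (hQ : Q.Finite)
    {ε : ℝ} (hε : 0 < ε) : ∀ᶠ η in 𝓝[>] (0 : ℝ), ∀ w : E d,
      (∀ p ∈ P, ∃ q ∈ Q, dist p (Tile.shift w q) < η) →
        ∃ w₀, dist w w₀ < ε ∧ ∀ p ∈ P, ∃ q ∈ Q, Tile.shift w₀ q = p := by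
  rcases P.eq_empty_or_nonempty with rfl | hne
  · exact Eventually.of_forall fun η w _ => ⟨w, by rwa [dist_self], by simp⟩
  have := hP.fintype
  have := hQ.to_subtype
  have := hne.to_subtype
  have hmatch : ∀ f : P → Q, ∀ᶠ η in 𝓝[>] (0 : ℝ), ∀ w : E d,
      (∀ p, dist p.1 (Tile.shift w (f p).1) < η) →
        ∃ w₀, dist w w₀ < ε ∧ ∀ p, Tile.shift w₀ (f p).1 = p.1 := fun f => by
    obtain ⟨η, hη, h⟩ := exists_eq_of_isometry_of_dist_lt
      (Tile.isometry_shift_pi fun p => (f p).1) Subtype.val hε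
    filter_upwards [Ioc_mem_nhdsGT hη] with η' hη' w hw
    obtain ⟨w₀, hw₀, hdist⟩ := h w ((dist_pi_lt_iff hη).2 fun p => (hw p).trans_le hη'.2)
    exact ⟨w₀, hdist, congrFun hw₀⟩
  filter_upwards [eventually_all.2 hmatch] with η hη w hw
  choose! q hqQ hq using hw
  obtain ⟨w₀, hdist, hw₀⟩ := hη (fun p => ⟨q p, hqQ p p.2⟩) w fun p => hq p p.2
  exact ⟨w₀, hdist, fun p hp => ⟨q p, hqQ p hp, hw₀ ⟨p, hp⟩⟩⟩

namespace TilingSpace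

variable {Ω : TilingSpace d X}

theorem FLC.exists_finite_patches (hΩ : Ω.FLC) {R : ℝ} (hR : 0 < R) :
    ∃ F : Set (Pattern d X), F.Finite ∧ (∀ P ∈ F, P.tiles.Finite) ∧
      ∀ T ∈ Ω.carrier, ∃ P ∈ F, ∃ y, T.patch 0 R = P.shift y := by
  obtain ⟨r, hr, D, hreg⟩ := Ω.exists_isRegular
  obtain ⟨F, hF, hFT⟩ := hΩ R hR
  refine ⟨F ∩ {P | P.tiles.Finite}, hF.inter_of_left _, fun P hP => hP.2, fun T hT => ?_⟩
  obtain ⟨P, hP, y, hPy⟩ := hFT T hT 0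
  have hfin := (hreg T hT).finite_patch hr R
  rw [hPy] at hfin
  exact ⟨P, ⟨hP, hfin.of_finite_image (Pattern.shift_injective y).injOn⟩, y, hPy⟩

theorem FLC.eventually_patch_subset_shift_patch (hΩ : Ω.FLC) {R R' ε : ℝ} (hR : 0 < R)
    (hR' : 0 < R') (hε : 0 < ε) : ∀ᶠ η in 𝓝[>] (0 : ℝ), ∀ T ∈ Ω.carrier, ∀ T' ∈ Ω.carrier,
      (∀ t ∈ (T.patch 0 R).tiles, ∃ u ∈ (T'.patch 0 R').tiles, dist t u < η) →
        ∃ z, ‖z‖ < ε ∧ (T.patch 0 R).tiles ⊆ ((T'.patch 0 R').shift z).tiles := by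
  obtain ⟨F, hF, hFfin, hFT⟩ := hΩ.exists_finite_patches hR
  obtain ⟨F', hF', hFfin', hFT'⟩ := hΩ.exists_finite_patches hR'
  have hunif := (eventually_all_finite hF).2 fun P hP => (eventually_all_finite hF').2 fun P' hP' =>
    Tile.eventually_exists_shift_eq (hFfin P hP) (hFfin' P' hP') hε
  filter_upwards [hunif] with η hη T hT T' hT' hmatch
  obtain ⟨P, hP, y, hPy⟩ := hFT T hT
  obtain ⟨P', hP', y', hPy'⟩ := hFT' T' hT'
  rw [hPy, hPy'] at hmatch ⊢
  obtain ⟨w, hw, hPP'⟩ := hη P hP P' hP' (y' - y) fun p hp => by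
    obtain ⟨_, ⟨q, hq, rfl⟩, hpq⟩ := hmatch _ ⟨p, hp, rfl⟩
    refine ⟨q, hq, ?_⟩
    rwa [← Pattern.dist_shift y, Tile.shift_shift, sub_add_cancel]
  refine ⟨w - (y' - y), by rwa [← dist_eq_norm, dist_comm], ?_⟩
  rintro _ ⟨p, hp, rfl⟩
  obtain ⟨q, hq, rfl⟩ := hPP' p hp
  refine ⟨_, ⟨q, hq, rfl⟩, ?_⟩
  rw [Tile.shift_shift, Tile.shift_shift, show y' + (w - (y' - y)) = w + y by abel]

theorem FLC.exists_patch_subset_shift (hΩ : Ω.FLC) {R ε : ℝ} (hR : 0 < R) (hε : 0 < ε) :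
    ∃ η > 0, ∀ T ∈ Ω.carrier, ∀ T' ∈ Ω.carrier, Pattern.Close η T T' →
      ∃ z, ‖z‖ < ε ∧ (T.patch 0 R).tiles ⊆ (T'.shift z).tiles := by
  obtain ⟨η, hη, hη0, hη1⟩ := ((hΩ.eventually_patch_subset_shift_patch hR
    (add_pos hR one_pos) hε).and (Ioo_mem_nhdsGT (show 0 < min 1 R⁻¹ by positivity))).exists
  have hRη : ball (0 : E d) R ⊆ ball 0 η⁻¹ :=
    ball_subset_ball ((le_inv_comm₀ hR hη0).2 (hη1.le.trans (min_le_right _ _)))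
  refine ⟨η, hη0, fun T hT T' hT' ⟨M, hM, _, hMt, _⟩ => ?_⟩
  obtain ⟨z, hz, hsub⟩ := hη T hT T' hT' fun t ht => by
    obtain ⟨u, hu⟩ := hMt t ⟨ht.1, ht.2.mono (inter_subset_inter_right _ hRη)⟩
    obtain ⟨-, huT', hdist⟩ := hM t u hu
    exact ⟨u, ⟨huT', Pattern.meets_of_dist_lt (hdist.trans (hη1.trans_le (min_le_left _ _))) ht.2⟩,
      hdist⟩
  exact ⟨z, hz, hsub.trans (image_mono fun _ ht => ht.1)⟩

theorem FLC.exists_samePatch_tmove (hΩ : Ω.FLC) (R : ℝ) {ε : ℝ} (hε : 0 < ε) :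
    ∃ U ∈ uniformity Ω, ∀ T T' : Ω, (T, T') ∈ U → ∃ z, ‖z‖ < ε ∧ SamePatch R T (tmove T' z) := by
  obtain ⟨r, hr, D, hreg⟩ := Ω.exists_isRegular
  obtain ⟨ρ, hρ, hne⟩ := Ω.exists_patch_nonempty
  obtain ⟨δ, hδ, hδε, hδr, hδ1⟩ : ∃ δ > 0, δ ≤ ε ∧ δ ≤ r / 2 ∧ δ ≤ 1 :=
    ⟨min ε (min (r / 2) 1), by positivity, by simp⟩
  obtain ⟨η, hη, hsub⟩ := hΩ.exists_patch_subset_shift (R := max R ρ + 1) (by positivity) hδ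
  refine ⟨_, Ω.uniformity_hasBasis.mem_of_mem hη, fun T T' hTT' => ?_⟩
  obtain ⟨z, hz, hTz⟩ := hsub T T.2 T' T'.2 hTT'
  obtain ⟨z', hz', hTz'⟩ := hsub T' T'.2 T T.2 hTT'.symm
  have hmem : ∀ {t : Tile d X} {s : ℝ}, s ≤ max R ρ → ((t.1 : Set (E d)) ∩ ball 0 s).Nonempty →
      t ∈ T.1.tiles → t ∈ (T'.1.shift z).tiles := fun hs hts ht =>
    hTz ⟨ht, hts.mono (inter_subset_inter_right _ (ball_subset_ball (by linarith)))⟩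
  have hmem' : ∀ {t : Tile d X} {s : ℝ}, s ≤ max R ρ → ((t.1 : Set (E d)) ∩ ball 0 s).Nonempty →
      t ∈ (T'.1.shift z).tiles → Tile.shift (-(z + z')) t ∈ T.1.tiles := fun hs hts ht => by
    rw [neg_add, ← Tile.shift_shift, ← Pattern.mem_shift]
    refine hTz' ⟨Pattern.mem_shift.1 ht, Tile.nonempty_shift_inter_ball.2 (hts.mono ?_)⟩
    refine inter_subset_inter_right _ (ball_subset_ball' ?_)
    rw [zero_add, dist_zero_left, norm_neg]
    linarith
  have hzz' : z + z' = 0 := by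
    obtain ⟨u, hu, hm⟩ := hne T T.2
    have hu' := hmem' (le_max_right _ _) hm (hmem (le_max_right _ _) hm hu)
    have hdist : dist (Tile.shift (-(z + z')) u) (Tile.shift 0 u) < r := by
      rw [Tile.dist_shift_left, dist_zero_right, norm_neg]
      linarith [norm_add_le z z']
    rw [← Tile.shift_zero u] at hu
    refine neg_eq_zero.1 (Tile.shift_left_injective u ((hreg T T.2).eq_of_dist_lt hu' hu hdist))
  refine ⟨z, hz.trans_le hδε, samePatch_iff.2 fun t ht =>
    ⟨hmem (le_max_left _ _) ht, fun htz => ?_⟩⟩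
  simpa only [hzz', neg_zero, Tile.shift_zero] using hmem' (le_max_left _ _) ht htz

end TilingSpace

end FLC

/-! ### Countable partitions into closed sets -/

section ClosedFibers

variable {Y ι : Type*} [TopologicalSpace Y] {c : Y → ι}

theorem exists_isOpen_inter_subset_fiber [LocallyCompactSpace Y] [T2Space Y] [Countable ι]
    (hc : ∀ i, IsClosed (c ⁻¹' {i})) {B : Set Y} (hB : IsClosed B) (hne : B.Nonempty) :
    ∃ i, ∃ O, IsOpen O ∧ (B ∩ O).Nonempty ∧ B ∩ O ⊆ c ⁻¹' {i} := by
  have : Nonempty B := hne.to_subtype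
  have : LocallyCompactSpace B := hB.locallyCompactSpace
  obtain ⟨i, b, hb⟩ := nonempty_interior_of_iUnion_of_closed
    (f := fun i => (Subtype.val ⁻¹' (c ⁻¹' {i}) : Set B))
    (fun i => (hc i).preimage continuous_subtype_val)
    (eq_univ_of_forall fun b => mem_iUnion.2 ⟨c b, rfl⟩)
  obtain ⟨_, hsub, ⟨O, hO, rfl⟩, hbO⟩ := mem_interior.1 hb
  exact ⟨i, O, hO, ⟨b, b.2, hbO⟩, fun y hy => hsub (a := ⟨y, hy.1⟩) hy.2⟩

theorem subset_fiber_of_isPreconnected (hc : ∀ i, IsClosed (c ⁻¹' {i})) {C : Set Y}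
    (hC : IsPreconnected C) {b : Y} (hb : b ∈ C)
    (hint : ∀ y ∈ C, c y ≠ c b → y ∈ interior (c ⁻¹' {c y})) : C ⊆ c ⁻¹' {c b} := by
  intro y hy
  by_contra hyb
  have hcover : C ⊆ interior (c ⁻¹' {c y}) ∪ (c ⁻¹' {c y})ᶜ := fun z hz => by
    by_cases hzy : c z = c y
    · exact .inl (hzy ▸ hint z hz (hzy ▸ hyb))
    · exact .inr hzy
  obtain ⟨z, -, hz, hz'⟩ := hC _ _ isOpen_interior (hc _).isOpen_compl hcover
    ⟨y, hy, hint y hy hyb⟩ ⟨b, hb, Ne.symm hyb⟩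
  exact hz' (interior_subset hz)

-- Sierpiński's theorem: otherwise, by Baire, some fibre contains a relatively open part of the
-- closed set of points at which `c` is not locally constant, hence all of a connected neighborhood.
theorem isLocallyConstant_of_isClosed_fiber [LocallyConnectedSpace Y] [LocallyCompactSpace Y]
    [T2Space Y] [Countable ι] (hc : ∀ i, IsClosed (c ⁻¹' {i})) : IsLocallyConstant c := by
  set G : Set Y := ⋃ i, interior (c ⁻¹' {i})
  have hG : ∀ y ∈ G, y ∈ interior (c ⁻¹' {c y}) := fun y hy => by
    obtain ⟨i, hi⟩ := mem_iUnion.1 hy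
    have hyi : y ∈ c ⁻¹' {i} := interior_subset hi
    obtain rfl : c y = i := hyi
    exact hi
  suffices hGc : ¬ Gᶜ.Nonempty by
    refine IsLocallyConstant.iff_isOpen_fiber.2 fun i => subset_interior_iff_isOpen.1 fun y hy => ?_
    obtain rfl : c y = i := hy
    exact hG y (not_not.1 fun h => hGc ⟨y, h⟩)
  intro hne
  obtain ⟨i, O, hO, ⟨b, hbG, hbO⟩, hsub⟩ := exists_isOpen_inter_subset_fiber hc
    (isOpen_iUnion fun _ => isOpen_interior).isClosed_compl hne
  have hfiber : connectedComponentIn O b ⊆ c ⁻¹' {c b} :=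
    subset_fiber_of_isPreconnected hc isPreconnected_connectedComponentIn
      (mem_connectedComponentIn hbO) fun y hy hyb => hG y <| not_not.1 fun hyG => hyb <|
        (hsub ⟨hyG, connectedComponentIn_subset O b hy⟩).trans (hsub ⟨hbG, hbO⟩).symm
  exact hbG (mem_iUnion.2 ⟨c b, interior_maximal hfiber hO.connectedComponentIn
    (mem_connectedComponentIn hbO)⟩)

theorem isOpen_setOf_dist_lt_of_gap [LocallyConnectedSpace Y] [LocallyCompactSpace Y] [T2Space Y]
    {M : Type*} [PseudoMetricSpace M] [SeparableSpace M] {g : Y → M} {a : ℝ} (ha : 0 < a)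
    (hgap : ∀ x y, dist (g x) (g y) ≤ 2 * a → dist (g x) (g y) < a)
    (hcl : ∀ y, IsClosed {x | dist (g x) (g y) ≤ a}) (y : Y) :
    IsOpen {x | dist (g x) (g y) < a} := by
  let s : Setoid Y :=
    { r := fun x y => dist (g x) (g y) < a
      iseqv :=
        { refl := fun x => by rwa [dist_self]
          symm := fun {x y} h => by rwa [dist_comm]
          trans := fun {x y z} h h' =>
            hgap x z (by linarith [dist_triangle (g x) (g y) (g z)]) } }
  have hfiber : ∀ y, (Quotient.mk s ⁻¹' {⟦y⟧}) = {x | dist (g x) (g y) < a} := fun y =>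
    Set.ext fun x => Quotient.eq (r := s)
  have : Nonempty M := ⟨g y⟩
  choose n hn using fun i : Quotient s =>
    (denseRange_denseSeq M).exists_dist_lt (g i.out) (half_pos ha)
  have hinj : Function.Injective n := fun i j hij => by
    refine Quotient.out_equiv_out.1 (?_ : dist (g i.out) (g j.out) < a)
    have hj := hn j
    rw [← hij] at hj
    linarith [hn i, dist_triangle_right (g i.out) (g j.out) (denseSeq M (n i))]
  have : Countable (Quotient s) := hinj.countable
  have hloc : IsLocallyConstant (Quotient.mk s) := isLocallyConstant_of_isClosed_fiber fun i => by
    induction i using Quotient.inductionOn with | h y => ?_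
    rw [hfiber y]
    convert hcl y using 3 with x
    exact ⟨le_of_lt, fun h => hgap x y (by linarith)⟩
  exact hfiber y ▸ hloc.isOpen_fiber ⟦y⟧

end ClosedFibers

/-! ### Continuity along orbits -/

section Orbits

variable {d : ℕ} {X : Type*} [MetricSpace X] {Ω : TilingSpace d X} [CompactSpace Ω]

variable (Ω) in
theorem exists_forall_tmove_notMem_entourage {a : ℝ}
    (ha : 0 < a) (b : ℝ) : ∃ U ∈ uniformity Ω, ∀ (S : Ω) (v : E d),
      a ≤ ‖v‖ → ‖v‖ ≤ b → (S, tmove S v) ∉ U := by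
  have hK : IsCompact (closedBall (0 : E d) b \ ball 0 a) :=
    (isCompact_closedBall 0 b).diff isOpen_ball
  have hgraph : Continuous fun p : Ω × E d => (p.1, tmove p.1 p.2) := by fun_prop
  have hI := (isCompact_univ.prod hK).image hgraph
  refine ⟨((fun p : Ω × E d => (p.1, tmove p.1 p.2)) '' (univ ×ˢ (closedBall 0 b \ ball 0 a)))ᶜ,
    ?_, fun S v hva hvb hmem => hmem ⟨(S, v), ⟨mem_univ S, ?_⟩, rfl⟩⟩
  · rw [← nhdsSet_diagonal_eq_uniformity, hI.isClosed.isOpen_compl.mem_nhdsSet]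
    rintro ⟨S, S'⟩ hS ⟨⟨T, v⟩, ⟨-, -, hv⟩, h⟩
    obtain rfl : S = S' := hS
    obtain ⟨rfl, h⟩ := Prod.mk.inj h
    obtain rfl : v = 0 := tmove_injective T (h.trans (tmove_zero T).symm)
    exact hv (mem_ball_self ha)
  · rw [Set.mem_sdiff, mem_closedBall_zero_iff, mem_ball_zero_iff, not_lt]
    exact ⟨hvb, hva⟩

theorem exists_forall_tmove_mem_entourage {U : Set (Ω × Ω)} (hU : U ∈ uniformity Ω) :
    ∃ δ > 0, ∀ (T : Ω) (v : E d), ‖v‖ < δ → (T, tmove T v) ∈ U := by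
  have hev : ∀ᶠ v in 𝓝 (0 : E d), ∀ T ∈ (univ : Set Ω), (T, tmove T v) ∈ U := by
    refine isCompact_univ.eventually_forall_of_forall_eventually fun T _ => ?_
    have hgraph : Continuous fun p : E d × Ω => (p.2, tmove p.2 p.1) := by fun_prop
    refine (hgraph.tendsto (0, T)).eventually ?_
    simp only [tmove_zero]
    exact nhds_le_uniformity T hU
  obtain ⟨δ, hδ, hball⟩ := Metric.eventually_nhds_iff_ball.1 hev
  exact ⟨δ, hδ, fun T v hv => hball v (mem_ball_zero_iff.2 hv) T (mem_univ T)⟩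

theorem continuous_of_continuous_tmove {Y : Type*} [TopologicalSpace Y] [LocallyConnectedSpace Y]
    [LocallyCompactSpace Y] [T2Space Y] {S : Ω} {g : Y → E d}
    (hg : Continuous fun y => tmove S (g y)) : Continuous g := by
  refine continuous_iff_continuousAt.2 fun y₀ => Metric.tendsto_nhds.2 fun a ha => ?_
  obtain ⟨U, hU, hUa⟩ := exists_forall_tmove_notMem_entourage Ω ha (2 * a)
  obtain ⟨V, hV, hVs, hVU⟩ := comp_symm_mem_uniformity_sets hU
  obtain ⟨W, hWV, hWo, hyW⟩ := _root_.mem_nhds_iff.1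
    (Uniform.tendsto_nhds_right.1 (hg.tendsto y₀) hV)
  have hgap : ∀ x y : W, dist (g x) (g y) ≤ 2 * a → dist (g x) (g y) < a := fun x y hle => by
    by_contra! hlt
    rw [dist_comm, dist_eq_norm] at hle hlt
    refine hUa (tmove S (g x)) _ hlt hle (hVU ?_)
    rw [tmove_tmove, add_sub_cancel]
    exact ⟨_, hVs.symm _ _ (hWV x.2), hWV y.2⟩
  have hcl : ∀ y : W, IsClosed {x : W | dist (g x) (g y) ≤ a} := fun y => by
    have himage : IsClosed (tmove S '' closedBall (g y) a) :=
      ((isCompact_closedBall _ _).image (by fun_prop)).isClosed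
    convert himage.preimage (hg.comp continuous_subtype_val) using 1
    ext x
    exact ((tmove_injective S).mem_set_image (s := closedBall (g y) a) (a := g x)).symm
  have : LocallyConnectedSpace W := hWo.locallyConnectedSpace
  have : LocallyCompactSpace W := hWo.locallyCompactSpace
  have hopen := isOpen_setOf_dist_lt_of_gap (g := fun y : W => g y) ha hgap hcl ⟨y₀, hyW⟩
  filter_upwards [(hWo.isOpenMap_subtype_val _ hopen).mem_nhds ⟨⟨y₀, hyW⟩, by simpa, rfl⟩]
  rintro _ ⟨x, hx, rfl⟩
  exact hx

theorem continuous_of_continuous_tmove_of_norm_le {Y : Type*} [TopologicalSpace Y] {S : Y → Ω}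
    (hS : Continuous S) {g : Y → E d} {C : ℝ} (hC : ∀ y, ‖g y‖ ≤ C)
    (hg : Continuous fun y => tmove (S y) (g y)) : Continuous g := by
  have hgraph : IsClosedEmbedding fun p : Ω × closedBall (0 : E d) C => (p.1, tmove p.1 p.2) := by
    refine Continuous.isClosedEmbedding (by fun_prop) fun p q hpq => ?_
    obtain ⟨h1, h2⟩ := Prod.mk.inj hpq
    rw [h1] at h2
    exact Prod.ext h1 (Subtype.ext (tmove_injective _ h2))
  exact continuous_subtype_val.comp <| continuous_snd.comp <| hgraph.isInducing.continuous_iff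
    (f := fun y => (S y, ⟨g y, mem_closedBall_zero_iff.2 (hC y)⟩)) |>.2 (hS.prodMk hg)

end Orbits

/-! ### Cocycles of maps between tiling spaces -/

theorem exists_forall_nsmul_eq_of_norm_le {V : Type*} [NormedAddCommGroup V] [NormedSpace ℝ V]
    {δ : ℝ} (hδ : 0 < δ) (L : ℝ) :
    ∃ n : ℕ, ∀ v : V, ‖v‖ ≤ L → ∃ w : V, ‖w‖ < δ ∧ n • w = v := by
  obtain ⟨n, hn⟩ := exists_nat_gt (max (L / δ) 0)
  have hn₀ : (0 : ℝ) < n := (le_max_right _ _).trans_lt hn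
  refine ⟨n, fun v hv => ⟨(n : ℝ)⁻¹ • v, ?_, ?_⟩⟩
  · rw [norm_smul, norm_inv, Real.norm_natCast, inv_mul_lt_iff₀ hn₀]
    exact hv.trans_lt ((div_lt_iff₀ hδ).1 ((le_max_left _ _).trans_lt hn))
  · rw [← Nat.cast_smul_eq_nsmul ℝ, smul_inv_smul₀ hn₀.ne']

section Cocycles

variable {d : ℕ} {X X' : Type*} [MetricSpace X] [MetricSpace X'] {Ω : TilingSpace d X}
  {Ω' : TilingSpace d X'}

namespace IsOrbitEquivalence

variable {h : Ω ≃ₜ Ω'}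

theorem symm (hh : IsOrbitEquivalence h) : IsOrbitEquivalence h.symm := fun S => by
  obtain ⟨T, rfl⟩ := h.surjective S
  rw [← hh T, h.symm_apply_apply, ← image_comp, h.symm_comp_self, image_id]

theorem exists_isCocycleOf (hh : IsOrbitEquivalence h) : ∃ α, IsCocycleOf h α := by
  have hmem : ∀ T v, h (tmove T v) ∈ orb (h T) := fun T v => hh T ▸ mem_image_of_mem h ⟨v, rfl⟩
  choose α hα using hmem
  exact ⟨α, fun T v => (hα T v).symm⟩

end IsOrbitEquivalence

namespace IsCocycleOf

variable {h : Ω → Ω'} {α β : Ω → E d → E d}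

theorem map_add (hα : IsCocycleOf h α) (T : Ω) (v w : E d) :
    α T v + α (tmove T v) w = α T (v + w) :=
  tmove_injective (h T) <| by rw [← tmove_tmove, ← hα, ← hα, tmove_tmove, hα]

theorem map_zero (hα : IsCocycleOf h α) (T : Ω) : α T 0 = 0 :=
  tmove_injective (h T) <| by rw [← hα, tmove_zero, tmove_zero]

theorem map_nsmul (hα : IsCocycleOf h α) (T : Ω) (n : ℕ) (v : E d) :
    α T (n • v) = ∑ k ∈ Finset.range n, α (tmove T (k • v)) v := by
  induction n with
  | zero => simp [hα.map_zero]
  | succ n ih => rw [Finset.sum_range_succ, ← ih, succ_nsmul, hα.map_add]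

theorem unique (hα : IsCocycleOf h α) (hβ : IsCocycleOf h β) : α = β :=
  funext₂ fun T v => tmove_injective (h T) <| by rw [← hα, ← hβ]

theorem perturb (hα : IsCocycleOf h α) (s : Ω → E d) :
    IsCocycleOf (fun T => tmove (h T) (s T)) (α + coboundary s) := fun T v => by
  simp only [Pi.add_apply, coboundary, hα T v, tmove_tmove]
  congr 1
  abel

theorem injective (hα : IsCocycleOf h α) (hh : Function.Injective h) (T : Ω) :
    Function.Injective (α T) := fun v w hvw =>
  tmove_injective T <| hh <| by rw [hα, hα, hvw]

theorem surjective {h : Ω ≃ₜ Ω'} (hα : IsCocycleOf h α) (hh : IsOrbitEquivalence h) (T : Ω) :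
    Function.Surjective (α T) := fun w => by
  obtain ⟨_, ⟨v, rfl⟩, hv⟩ : tmove (h T) w ∈ h '' orb T := hh T ▸ mem_range_self w
  exact ⟨v, tmove_injective (h T) ((hα T v).symm.trans hv)⟩

variable [CompactSpace Ω']

theorem continuous_apply (hα : IsCocycleOf h α) (hh : Continuous h) (T : Ω) :
    Continuous (α T) := by
  refine continuous_of_continuous_tmove (S := h T) ?_
  simp only [← hα T]
  fun_prop

variable [CompactSpace Ω]

theorem exists_norm_lt (hα : IsCocycleOf h α) (hh : Continuous h) {a : ℝ} (ha : 0 < a) :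
    ∃ δ > 0, ∀ T v, ‖v‖ < δ → ‖α T v‖ < a := by
  obtain ⟨U, hU, hUa⟩ := exists_forall_tmove_notMem_entourage Ω' ha a
  obtain ⟨δ, hδ, hmem⟩ := exists_forall_tmove_mem_entourage
    (CompactSpace.uniformContinuous_of_continuous hh hU)
  refine ⟨δ, hδ, fun T v hv => ?_⟩
  by_contra! hle
  obtain ⟨w, hw, hwa : ‖α T w‖ = a⟩ := (convex_ball 0 δ).isPreconnected.intermediate_value
    (mem_ball_self hδ) (mem_ball_zero_iff.2 hv) (hα.continuous_apply hh T).norm.continuousOn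
    ⟨by simpa only [hα.map_zero, norm_zero] using ha.le, hle⟩
  exact hUa (h T) (α T w) hwa.ge hwa.le (hα T w ▸ hmem T w (mem_ball_zero_iff.1 hw))

theorem exists_norm_le (hα : IsCocycleOf h α) (hh : Continuous h) (L : ℝ) :
    ∃ C, ∀ T v, ‖v‖ ≤ L → ‖α T v‖ ≤ C := by
  obtain ⟨δ, hδ, hlt⟩ := hα.exists_norm_lt hh one_pos
  obtain ⟨n, hn⟩ := exists_forall_nsmul_eq_of_norm_le (V := E d) hδ L
  refine ⟨n, fun T v hv => ?_⟩
  obtain ⟨w, hw, rfl⟩ := hn v hv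
  rw [hα.map_nsmul]
  exact (norm_sum_le_of_le _ fun k _ => (hlt _ w hw).le).trans_eq (by simp)

theorem continuous (hα : IsCocycleOf h α) (hh : Continuous h) :
    Continuous fun p : Ω × E d => α p.1 p.2 := by
  refine continuous_iff_continuousAt.2 fun ⟨T, x⟩ => ?_
  obtain ⟨C, hC⟩ := hα.exists_norm_le hh (‖x‖ + 1)
  set O : Set (Ω × E d) := {p | ‖p.2‖ < ‖x‖ + 1}
  have hO : IsOpen O := isOpen_lt (by fun_prop) continuous_const
  refine ContinuousOn.continuousAt (s := O) ?_ (hO.mem_nhds (lt_add_one ‖x‖))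
  refine continuousOn_iff_continuous_domRestrict.2 <|
    continuous_of_continuous_tmove_of_norm_le (S := fun p : O => h p.1.1) (by fun_prop)
      (fun p => hC p.1.1 p.1.2 (le_of_lt p.2)) ?_
  simp only [domRestrict_apply, ← hα _ _]
  fun_prop

theorem mem_weakCocycles (hα : IsCocycleOf h α) (hh : Continuous h) : α ∈ weakCocycles Ω :=
  ⟨hα.continuous hh, hα.map_add⟩

end IsCocycleOf

theorem IsOrbitEquivalence.exists_tmove_eq [CompactSpace Ω] [CompactSpace Ω'] {h : Ω ≃ₜ Ω'}
    (hh : IsOrbitEquivalence h) {σ : Ω → E d} (hσ : Continuous σ) :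
    ∃ s : Ω → E d, Continuous s ∧ ∀ T, h (tmove T (s T)) = tmove (h T) (σ T) := by
  obtain ⟨β, hβ⟩ := hh.symm.exists_isCocycleOf
  refine ⟨fun T => β (h T) (σ T), (hβ.continuous h.symm.continuous).comp
    (h.continuous.prodMk hσ), fun T => ?_⟩
  rw [← h.eq_symm_apply, hβ, h.symm_apply_apply]

end Cocycles

/-! ### Maps with the same cocycle -/

section Conjugacy

variable {d : ℕ} {X X₁ X₂ : Type*} [MetricSpace X] [MetricSpace X₁] [MetricSpace X₂]
  {Ω : TilingSpace d X} {Ω₁ : TilingSpace d X₁} {Ω₂ : TilingSpace d X₂} {h₁ : Ω ≃ₜ Ω₁}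
  {h₂ : Ω ≃ₜ Ω₂} {α : Ω → E d → E d}

theorem IsCocycleOf.injective_of_tmove (hh : IsOrbitEquivalence h₂) {σ : Ω → E d}
    (hα : IsCocycleOf (fun T => tmove (h₂ T) (σ T)) α) (hinj : ∀ T, Function.Injective (α T)) :
    Function.Injective fun T => tmove (h₂ T) (σ T) := fun T T' hTT' => by
  replace hTT' : tmove (h₂ T) (σ T) = tmove (h₂ T') (σ T') := hTT'
  have hT' : h₂ T' ∈ h₂ '' orb T := by
    refine hh T ▸ ⟨σ T - σ T', ?_⟩
    rw [sub_eq_add_neg, ← tmove_tmove, hTT', tmove_tmove, add_neg_cancel, tmove_zero]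
  obtain ⟨v, rfl⟩ := h₂.injective.mem_set_image.1 hT'
  have hv : α T v = 0 := tmove_injective (tmove (h₂ T) (σ T)) <|
    (hα T v).symm.trans (hTT'.symm.trans (tmove_zero _).symm)
  rw [hinj T (hv.trans (hα.map_zero T).symm), tmove_zero]

theorem IsCocycleOf.surjective_of_continuous [CompactSpace Ω] [Nonempty Ω] {f : Ω → Ω₂}
    (hf : Continuous f) (hα : IsCocycleOf f α) (hsurj : ∀ T, Function.Surjective (α T)) :
    Function.Surjective f := by
  obtain ⟨T⟩ := ‹Nonempty Ω›
  have horb : orb (f T) ⊆ range f := by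
    rintro _ ⟨w, rfl⟩
    obtain ⟨v, rfl⟩ := hsurj T w
    exact ⟨tmove T v, hα T v⟩
  rw [← range_eq_univ, ← (isCompact_range hf).isClosed.closure_eq]
  exact ((dense_orb (f T)).mono horb).closure_eq

theorem isConjugacy_symm_trans (hh₁ : IsOrbitEquivalence h₁) (hα₁ : IsCocycleOf h₁ α)
    (hα₂ : IsCocycleOf h₂ α) : IsConjugacy (h₁.symm.trans h₂) := fun S w => by
  obtain ⟨T, rfl⟩ := h₁.surjective S
  obtain ⟨v, rfl⟩ := hα₁.surjective hh₁ T w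
  simp only [Homeomorph.trans_apply, ← hα₁ T v, h₁.symm_apply_apply, hα₂ T v]

theorem IsConjugacy.symm {φ : Ω₁ ≃ₜ Ω₂} (hφ : IsConjugacy φ) : IsConjugacy φ.symm := fun S x => by
  rw [φ.symm_apply_eq, hφ, φ.apply_symm_apply]

theorem exists_isConjugacy_of_isCocycleOf [CompactSpace Ω] (hh₁ : IsOrbitEquivalence h₁)
    (hh₂ : IsOrbitEquivalence h₂) (hα₁ : IsCocycleOf h₁ α) {σ : Ω → E d} (hσ : Continuous σ)
    (hα₂ : IsCocycleOf (fun T => tmove (h₂ T) (σ T)) α) :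
    ∃ s : Ω → E d, Continuous s ∧ IsHomeomorph (fun T : Ω => tmove T (s T)) ∧
      ∃ φ : Ω₁ ≃ₜ Ω₂, IsConjugacy φ ∧ (∀ T, h₂ (tmove T (s T)) = φ (h₁ T)) ∧
        ∀ T, φ (h₁ T) = tmove (h₂ T) (σ T) := by
  have : CompactSpace Ω₂ := h₂.compactSpace
  have hf : Continuous fun T => tmove (h₂ T) (σ T) := by fun_prop
  have hbij : Function.Bijective fun T => tmove (h₂ T) (σ T) :=
    ⟨hα₂.injective_of_tmove hh₂ (hα₁.injective h₁.injective),
      fun S => have : Nonempty Ω := ⟨h₂.symm S⟩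
        hα₂.surjective_of_continuous hf (hα₁.surjective hh₁) S⟩
  let F : Ω ≃ₜ Ω₂ := Continuous.homeoOfEquivCompactToT2 (f := Equiv.ofBijective _ hbij) hf
  have hF : ∀ T, F T = tmove (h₂ T) (σ T) := fun _ => rfl
  obtain ⟨s, hs, hsσ⟩ := hh₂.exists_tmove_eq hσ
  have hsF : ∀ T, tmove T (s T) = F.trans h₂.symm T := fun T => by
    rw [F.trans_apply, h₂.eq_symm_apply, hsσ, hF]
  refine ⟨s, hs, funext hsF ▸ (F.trans h₂.symm).isHomeomorph, h₁.symm.trans F,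
    isConjugacy_symm_trans hh₁ hα₁ hα₂, fun T => ?_, fun T => ?_⟩
  · rw [hsσ, Homeomorph.trans_apply, h₁.symm_apply_apply, hF]
  · rw [Homeomorph.trans_apply, h₁.symm_apply_apply, hF]

theorem exists_isConjugacy_of_common_isCocycleOf [CompactSpace Ω] (hh₁ : IsOrbitEquivalence h₁)
    (hh₂ : IsOrbitEquivalence h₂) {s₁ s₂ : Ω → E d} (hs₁ : Continuous s₁) (hs₂ : Continuous s₂)
    (hα₁ : IsCocycleOf (fun T => tmove (h₁ T) (s₁ T)) α)
    (hα₂ : IsCocycleOf (fun T => tmove (h₂ T) (s₂ T)) α) :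
    ∃ s : Ω → E d, Continuous s ∧ IsHomeomorph (fun T : Ω => tmove T (s T)) ∧
      ∃ φ : Ω₁ ≃ₜ Ω₂, IsConjugacy φ ∧ (∀ T, h₂ (tmove T (s T)) = φ (h₁ T)) ∧
        ∀ T, φ (tmove (h₁ T) (s₁ T)) = tmove (h₂ T) (s₂ T) := by
  have hα₁' := hα₁.perturb (-s₁)
  have hα₂' := hα₂.perturb (-s₁)
  simp only [tmove_tmove, Pi.neg_apply, add_neg_cancel, tmove_zero] at hα₁' hα₂'
  obtain ⟨s, hs, hsh, φ, hφ, hsφ, hφσ⟩ :=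
    exists_isConjugacy_of_isCocycleOf hh₁ hh₂ hα₁' (hs₂.add hs₁.neg) hα₂'
  refine ⟨s, hs, hsh, φ, hφ, hsφ, fun T => ?_⟩
  simp only [hφ (h₁ T), hφσ, tmove_tmove, Pi.neg_apply, Pi.add_apply, neg_add_cancel_right]

end Conjugacy

/-! ### Partitions of unity depending on patches -/

section LocalPartition

variable {d : ℕ} {X : Type*} [MetricSpace X] {Ω : TilingSpace d X} {R η : ℝ} {T₀ T T' : Ω}

/-- A bump function at `T₀` that depends on patches only: its value at `T` is `max (η - ‖y‖) 0`,
where `y` is a shortest vector such that `T - y` and `T₀` have the same patch of radius `R`, and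
it is `0` if there is no such vector. -/
noncomputable def bump (R η : ℝ) (T₀ T : Ω) : ℝ :=
  ⨆ y : {y : E d // SamePatch R T₀ (tmove T y)}, max (η - ‖(y : E d)‖) 0

theorem bump_nonneg : 0 ≤ bump R η T₀ T := Real.iSup_nonneg fun _ => le_max_right _ _

theorem le_bump {y : E d} (h : SamePatch R T₀ (tmove T y)) : η - ‖y‖ ≤ bump R η T₀ T := by
  have hbdd : BddAbove (range fun y : {y : E d // SamePatch R T₀ (tmove T y)} =>
      max (η - ‖(y : E d)‖) 0) :=
    ⟨max η 0, forall_mem_range.2 fun y => max_le_max_right 0 (sub_le_self η (norm_nonneg _))⟩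
  exact (le_max_left _ _).trans (le_ciSup hbdd ⟨y, h⟩)

theorem exists_samePatch_of_bump_ne_zero (h : bump R η T₀ T ≠ 0) :
    ∃ y : E d, ‖y‖ < η ∧ SamePatch R T₀ (tmove T y) := by
  by_contra! hη
  refine h ((Real.iSup_le (fun y => max_le ?_ le_rfl) le_rfl).antisymm bump_nonneg)
  exact sub_nonpos.2 (not_lt.1 fun hy => hη y hy y.2)

theorem bump_le_add {z : E d} (h : SamePatch (R + η) T (tmove T' z)) :
    bump R η T₀ T ≤ bump R η T₀ T' + ‖z‖ := by
  have hnonneg : 0 ≤ bump R η T₀ T' + ‖z‖ := add_nonneg bump_nonneg (norm_nonneg z)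
  refine Real.iSup_le (fun ⟨y, hy⟩ => max_le ?_ hnonneg) hnonneg
  rcases le_or_gt η ‖y‖ with hle | hlt
  · linarith
  · have hzy : SamePatch R T₀ (tmove T' (z + y)) :=
      tmove_tmove T' z y ▸ hy.trans (h.tmove (by linarith))
    linarith [le_bump (η := η) hzy, norm_add_le z y]

theorem bump_congr (h : SamePatch (R + η) T T') : bump R η T₀ T = bump R η T₀ T' := by
  have hle : ∀ {T T' : Ω}, SamePatch (R + η) T T' → bump R η T₀ T ≤ bump R η T₀ T' :=
    fun {T T'} h => by simpa using bump_le_add (z := 0) (T' := T') (by rwa [tmove_zero])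
  exact (hle h).antisymm (hle h.symm)

namespace TilingSpace.FLC

theorem continuous_bump (hΩ : Ω.FLC) (R η : ℝ) (T₀ : Ω) : Continuous (bump R η T₀) := by
  refine continuous_iff_continuousAt.2 fun T => Metric.tendsto_nhds.2 fun ε hε => ?_
  obtain ⟨U, hU, hex⟩ := hΩ.exists_samePatch_tmove (R + η) hε
  filter_upwards [mem_nhds_left T hU, mem_nhds_right T hU] with T' hTT' hT'T
  obtain ⟨z, hz, hTz⟩ := hex _ _ hTT'
  obtain ⟨z', hz', hTz'⟩ := hex _ _ hT'T
  rw [Real.dist_eq, abs_lt]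
  constructor <;> linarith [bump_le_add (T₀ := T₀) hTz', bump_le_add (T₀ := T₀) hTz]

theorem exists_local_partition [CompactSpace Ω] (hΩ : Ω.FLC) {V : Set (Ω × Ω)}
    (hV : V ∈ uniformity Ω) : ∃ (F : Finset Ω) (b : Ω → Ω → ℝ), (∀ i, Continuous (b i)) ∧
      (∀ i T, 0 ≤ b i T) ∧ (∀ T, ∑ i ∈ F, b i T = 1) ∧ (∀ i T, b i T ≠ 0 → (i, T) ∈ V) ∧
      ∃ R > 0, ∀ T T', SamePatch R T T' → ∀ i, b i T = b i T' := by
  obtain ⟨W, hW, hWs, hWV⟩ := comp_symm_mem_uniformity_sets hV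
  obtain ⟨R, hR, hRW⟩ := Ω.exists_samePatch_imp_mem hW
  obtain ⟨η, hη, hηW⟩ := exists_forall_tmove_mem_entourage hW
  have hbump : ∀ i, Continuous (bump R η i) := hΩ.continuous_bump R η
  have hself : ∀ T : Ω, 0 < bump R η T T := fun T =>
    hη.trans_le <| by simpa using le_bump (η := η) (y := 0) (by rw [tmove_zero]; rfl)
  obtain ⟨F, -, hF⟩ := isCompact_univ.elim_nhds_subcover (fun T₀ : Ω => {T | 0 < bump R η T₀ T})
    fun T₀ _ => (isOpen_lt continuous_const (hbump T₀)).mem_nhds (hself T₀)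
  have hpos : ∀ T, 0 < ∑ i ∈ F, bump R η i T := fun T => by
    obtain ⟨i, hi, hiT⟩ := mem_iUnion₂.1 (hF (mem_univ T))
    exact Finset.sum_pos' (fun j _ => bump_nonneg) ⟨i, hi, hiT⟩
  refine ⟨F, fun i T => bump R η i T / ∑ j ∈ F, bump R η j T, fun i => ?_, fun i T => ?_,
    fun T => ?_, fun i T hiT => ?_, R + η, by positivity, fun T T' hTT' i => ?_⟩
  · exact (hbump i).div (continuous_finsetSum _ fun j _ => hbump j) fun T => (hpos T).ne'
  · exact div_nonneg bump_nonneg (hpos T).le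
  · rw [← Finset.sum_div, div_self (hpos T).ne']
  · obtain ⟨y, hy, hiy⟩ := exists_samePatch_of_bump_ne_zero (div_ne_zero_iff.1 hiT).1
    exact hWV ⟨tmove T y, hRW _ _ hiy, hWs.symm _ _ (hηW T y hy)⟩
  · simp only [bump_congr hTT']

end TilingSpace.FLC

end LocalPartition

/-! ### Local perturbations of continuous maps -/

theorem continuous_smul_of_continuousOn_support {Y V : Type*} [TopologicalSpace Y]
    [NormedAddCommGroup V] [NormedSpace ℝ V] {b : Y → ℝ} (hb : Continuous b) {x : Y → V} {C : ℝ}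
    (hC : ∀ y, ‖x y‖ ≤ C) (hx : ContinuousOn x (Function.support b)) :
    Continuous fun y => b y • x y := by
  refine continuous_iff_continuousAt.2 fun y => ?_
  by_cases hy : b y = 0
  · have hby : Tendsto b (𝓝 y) (𝓝 0) := hy ▸ hb.tendsto y
    rw [ContinuousAt, hy, zero_smul]
    exact hby.zero_smul_isBoundedUnder_le (isBoundedUnder_of ⟨C, hC⟩)
  · exact hb.continuousAt.smul (hx.continuousAt (hb.isOpen_support.mem_nhds hy))

theorem sum_smul_eq_add_sum_smul {ι V : Type*} [AddCommGroup V] [Module ℝ V] {F : Finset ι}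
    {b : ι → ℝ} (hb : ∑ i ∈ F, b i = 1) {x x' : ι → V} {z : V}
    (hx : ∀ i ∈ F, b i ≠ 0 → x' i = z + x i) :
    ∑ i ∈ F, b i • x' i = z + ∑ i ∈ F, b i • x i := by
  rw [← one_smul ℝ z, ← hb, Finset.sum_smul, ← Finset.sum_add_distrib]
  refine Finset.sum_congr rfl fun i hi => ?_
  rcases eq_or_ne (b i) 0 with hbi | hbi
  · simp only [hbi, zero_smul, add_zero]
  · rw [hx i hi hbi, smul_add]

section Perturbation

variable {d : ℕ} {X X' : Type*} [MetricSpace X] [MetricSpace X'] {Ω : TilingSpace d X}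
  {Ω' : TilingSpace d X'}

theorem TilingSpace.IsRigid.exists_displacement {r R δ ρ : ℝ} (hrR : Ω.IsRigid r R)
    (hδ : 0 < δ) (hδr : 3 * δ ≤ r) (hRρ : R + δ ≤ ρ) {U : Set (Ω × Ω)}
    (hU : ∀ T T', (T, T') ∈ U → ∃ z, ‖z‖ < δ ∧ SamePatch ρ T (tmove T' z)) :
    ∃ x : Ω → Ω → E d, (∀ S T, ‖x S T‖ ≤ δ) ∧ ∀ S T T' z, (S, T) ∈ U → (S, T') ∈ U → ‖z‖ < δ →
      SamePatch ρ T (tmove T' z) → x S T' = z + x S T := by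
  have hex : ∀ S T : Ω, ∃ x : E d, ‖x‖ ≤ δ ∧ ((S, T) ∈ U → SamePatch ρ S (tmove T x)) := by
    intro S T
    by_cases hST : (S, T) ∈ U
    · obtain ⟨z, hz, hSz⟩ := hU S T hST
      exact ⟨z, hz.le, fun _ => hSz⟩
    · exact ⟨0, norm_zero.trans_le hδ.le, fun h => absurd h hST⟩
  choose x hxδ hx using hex
  refine ⟨x, hxδ, fun S T T' z hST hST' hz hTz => ?_⟩
  refine hrR.eq_add ((hx S T hST).mono (by linarith)) ((hx S T' hST').mono (by linarith))
    (hTz.mono (by linarith [hxδ S T])) ?_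
  calc ‖x S T' - (z + x S T)‖ ≤ ‖x S T'‖ + ‖z + x S T‖ := norm_sub_le _ _
    _ ≤ ‖x S T'‖ + (‖z‖ + ‖x S T‖) := by gcongr; exact norm_add_le _ _
    _ < r := by linarith [hxδ S T, hxδ S T']

theorem TilingSpace.FLC.continuousOn_of_displacement (hΩ : Ω.FLC) {δ ρ : ℝ} (hδ : 0 < δ)
    {A : Set Ω} {x : Ω → E d} (hx : ∀ T ∈ A, ∀ T' ∈ A, ∀ z, ‖z‖ < δ →
      SamePatch ρ T (tmove T' z) → x T' = z + x T) : ContinuousOn x A := by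
  refine fun T hT => Metric.tendsto_nhds.2 fun ε hε => ?_
  obtain ⟨U, hU, hex⟩ := hΩ.exists_samePatch_tmove ρ (lt_min hε hδ)
  filter_upwards [self_mem_nhdsWithin, mem_nhdsWithin_of_mem_nhds (mem_nhds_left T hU)]
    with T' hT' hTT'
  obtain ⟨z, hz, hTz⟩ := hex T T' hTT'
  rw [hx T hT T' hT' z (hz.trans_le (min_le_right _ _)) hTz, dist_eq_norm, add_sub_cancel_right]
  exact hz.trans_le (min_le_left _ _)

theorem TilingSpace.FLC.exists_local_perturbation [CompactSpace Ω] (hΩ : Ω.FLC) (hΩ' : Ω'.FLC)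
    {h : Ω → Ω'} (hh : UniformContinuous h) (r : ℝ) {ε : ℝ} (hε : 0 < ε) :
    ∃ s : Ω → E d, Continuous s ∧ (∀ T, ‖s T‖ ≤ ε) ∧ ∃ R > 0, ∀ T T' : Ω, SamePatch R T T' →
      SamePatch r (tmove (h T) (s T)) (tmove (h T') (s T')) := by
  obtain ⟨r₀, hr₀, R₀, -, hrR⟩ := Ω'.exists_isRigid
  obtain ⟨δ, hδ, hδε, hδr⟩ : ∃ δ > 0, δ ≤ ε ∧ δ ≤ r₀ / 3 :=
    ⟨min ε (r₀ / 3), by positivity, min_le_left _ _, min_le_right _ _⟩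
  obtain ⟨ρ, hrρ, hRρ⟩ : ∃ ρ, r + δ ≤ ρ ∧ R₀ + δ ≤ ρ := ⟨_, le_max_left _ _, le_max_right _ _⟩
  obtain ⟨U, hU, hUz⟩ := hΩ'.exists_samePatch_tmove ρ hδ
  obtain ⟨x, hxδ, hx⟩ := hrR.exists_displacement hδ (by linarith) hRρ hUz
  obtain ⟨F, b, hb, hb₀, hb₁, hbU, R₁, hR₁, hbR₁⟩ := hΩ.exists_local_partition (hh hU)
  obtain ⟨R₂, -, hUR₂⟩ := Ω.exists_samePatch_imp_mem (hh hU)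
  let s : Ω → E d := fun T => ∑ i ∈ F, b i T • x (h i) (h T)
  have hsδ : ∀ T, ‖s T‖ ≤ δ := fun T => mem_closedBall_zero_iff.1 <|
    (convex_closedBall 0 δ).sum_mem (fun i _ => hb₀ i T) (hb₁ T) fun i _ =>
      mem_closedBall_zero_iff.2 (hxδ (h i) (h T))
  refine ⟨s, continuous_finsetSum _ fun i _ => ?_, fun T => (hsδ T).trans hδε, max R₁ R₂,
    lt_max_of_lt_left hR₁, fun T T' hTT' => ?_⟩
  · have hxU : ContinuousOn (x (h i)) {T | (h i, T) ∈ U} := hΩ'.continuousOn_of_displacement hδ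
      fun T hT T' hT' z => hx (h i) T T' z hT hT'
    exact continuous_smul_of_continuousOn_support (hb i) (fun T => hxδ (h i) (h T))
      (hxU.comp hh.continuous.continuousOn (hbU i))
  · obtain ⟨z, hz, hTz⟩ := hUz (h T) (h T') (hUR₂ T T' (hTT'.mono (le_max_right _ _)))
    have hbT : ∀ i, b i T' = b i T := fun i =>
      (hbR₁ T T' (hTT'.mono (le_max_left _ _)) i).symm
    have hsz : s T' = z + s T := by
      simp only [s, hbT]
      exact sum_smul_eq_add_sum_smul (hb₁ T) fun i _ hi =>
        hx (h i) _ _ z (hbU i T hi) (hbU i T' (hbT i ▸ hi)) hz hTz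
    rw [hsz, ← tmove_tmove]
    exact hTz.tmove (by linarith [hsδ T])

end Perturbation

/-! ### Strong representatives -/

section StrongRepresentative

variable {d : ℕ} {X X' : Type*} [MetricSpace X] [MetricSpace X'] {Ω : TilingSpace d X}
  {Ω' : TilingSpace d X'} [CompactSpace Ω] [CompactSpace Ω'] {f : Ω → Ω'} {γ : Ω → E d → E d}
  {r₀ R₀ R : ℝ}

theorem IsCocycleOf.exists_eq_of_samePatch (hγ : IsCocycleOf f γ) (hf : Continuous f)
    (hr₀ : 0 < r₀) (hrR : Ω'.IsRigid r₀ R₀) (hR : 0 < R)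
    (hloc : ∀ T T', SamePatch R T T' → SamePatch (R₀ + 1) (f T) (f T')) (L : ℝ) :
    ∃ R' > 0, ∀ T T' v, ‖v‖ ≤ L → SamePatch R' T T' → γ T v = γ T' v := by
  obtain ⟨δ, hδ, hγδ⟩ := hγ.exists_norm_lt hf (lt_min (half_pos hr₀) one_pos)
  have hγ₁ : ∀ T w, ‖w‖ < δ → ‖γ T w‖ < r₀ / 2 ∧ ‖γ T w‖ < 1 := fun T w hw =>
    lt_min_iff.1 (hγδ T w hw)
  have hshort : ∀ T T' w, ‖w‖ < δ → SamePatch (R + ‖w‖) T T' → γ T w = γ T' w := by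
    intro T T' w hw hTT'
    have hend := hloc _ _ (hTT'.tmove (add_comm _ _).le : SamePatch R (tmove T w) (tmove T' w))
    have hstart := hloc T T' (hTT'.mono (le_add_of_nonneg_right (norm_nonneg w)))
    rw [hγ, hγ] at hend
    refine hrR (f T') _ _ ?_ ((hstart.tmove ?_).symm.trans (hend.mono (by linarith)))
    · linarith [norm_sub_le (γ T w) (γ T' w), hγ₁ T w hw, hγ₁ T' w hw]
    · linarith [hγ₁ T w hw]
  obtain ⟨n, hn⟩ := exists_forall_nsmul_eq_of_norm_le (V := E d) hδ L
  refine ⟨R + (n + 1) * δ, by positivity, fun T T' v hv hTT' => ?_⟩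
  obtain ⟨w, hw, rfl⟩ := hn v hv
  rw [hγ.map_nsmul, hγ.map_nsmul]
  refine Finset.sum_congr rfl fun k hk => hshort _ _ w hw (hTT'.tmove ?_)
  have hkn : (k : ℝ) ≤ n := by exact_mod_cast (Finset.mem_range.1 hk).le
  calc ‖k • w‖ + (R + ‖w‖) ≤ k * ‖w‖ + (R + ‖w‖) := by gcongr; exact norm_nsmul_le
    _ ≤ n * δ + (R + δ) := by gcongr
    _ = R + (n + 1) * δ := by ring

theorem IsCocycleOf.isLocalMap (hγ : IsCocycleOf f γ) (hf : Continuous f)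
    (hr₀ : 0 < r₀) (hrR : Ω'.IsRigid r₀ R₀) (hR : 0 < R)
    (hloc : ∀ T T', SamePatch R T T' → SamePatch (R₀ + 1) (f T) (f T'))
    (hdense : ∀ r, ∃ C, ∀ T, ∀ p : E d, ‖p‖ < r → ∃ v, ‖v‖ ≤ C ∧ ‖p - γ T v‖ < R₀ + 1) :
    IsLocalMap f := by
  refine ⟨hf, fun r _ => ?_⟩
  obtain ⟨C, hC⟩ := hdense r
  obtain ⟨R', hR', hγR'⟩ := hγ.exists_eq_of_samePatch hf hr₀ hrR hR hloc C
  refine ⟨max R' (C + R), lt_max_of_lt_left hR', fun T T' hTT' => ?_⟩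
  refine SamePatch.of_forall_ball (ρ := R₀ + 1) fun p hp => ?_
  obtain ⟨v, hv, hpv⟩ := hC T p (mem_ball_zero_iff.1 hp)
  refine ⟨γ T v, hpv, ?_⟩
  rw [← hγ, hγR' T T' v hv (hTT'.mono (le_max_left _ _)), ← hγ]
  exact hloc _ _ (hTT'.tmove ((add_le_add_left hv R).trans (le_max_right _ _)))

theorem IsCocycleOf.mem_strongCocycles (hγ : IsCocycleOf f γ) (hf : Continuous f)
    (hr₀ : 0 < r₀) (hrR : Ω'.IsRigid r₀ R₀) (hR : 0 < R)
    (hloc : ∀ T T', SamePatch R T T' → SamePatch (R₀ + 1) (f T) (f T')) :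
    γ ∈ strongCocycles Ω := by
  refine ⟨hγ.mem_weakCocycles hf, fun v =>
    ⟨(hγ.continuous hf).comp (continuous_id.prodMk continuous_const), ?_⟩⟩
  obtain ⟨R', hR', hγR'⟩ := hγ.exists_eq_of_samePatch hf hr₀ hrR hR hloc ‖v‖
  exact ⟨R', hR', fun T T' => hγR' T T' v le_rfl⟩

theorem IsCocycleOf.exists_apply_eq_of_norm_le {h : Ω ≃ₜ Ω'} {α : Ω → E d → E d}
    (hα : IsCocycleOf h α) (hh : IsOrbitEquivalence h) (r : ℝ) :
    ∃ C, ∀ T p, ‖p‖ ≤ r → ∃ v, ‖v‖ ≤ C ∧ α T v = p := by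
  obtain ⟨β, hβ⟩ := hh.symm.exists_isCocycleOf
  obtain ⟨C, hC⟩ := hβ.exists_norm_le h.symm.continuous r
  refine ⟨C, fun T p hp => ⟨β (h T) p, hC _ p hp, tmove_injective (h T) ?_⟩⟩
  rw [← hα, ← h.eq_symm_apply, hβ, h.symm_apply_apply]

theorem IsOrbitEquivalence.exists_isStrongRepresentative {h : Ω ≃ₜ Ω'}
    (hh : IsOrbitEquivalence h) (hΩ : Ω.FLC) (hΩ' : Ω'.FLC) :
    ∃ α : strongCocycles Ω, IsStrongRepresentative h α := by
  obtain ⟨r₀, hr₀, R₀, hR₀, hrR⟩ := Ω'.exists_isRigid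
  obtain ⟨s, hs, hs₃, R, hR, hloc⟩ := hΩ.exists_local_perturbation hΩ'
    (CompactSpace.uniformContinuous_of_continuous h.continuous) (R₀ + 1)
    (by norm_num : (0 : ℝ) < 1 / 3)
  obtain ⟨α, hα⟩ := hh.exists_isCocycleOf
  have hγ := hα.perturb s
  have hf : Continuous fun T => tmove (h T) (s T) := by fun_prop
  refine ⟨⟨_, hγ.mem_strongCocycles hf hr₀ hrR hR hloc⟩, s, hs,
    hγ.isLocalMap hf hr₀ hrR hR hloc fun r => ?_, hγ⟩
  obtain ⟨C, hC⟩ := hα.exists_apply_eq_of_norm_le hh r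
  refine ⟨C, fun T p hp => ?_⟩
  obtain ⟨v, hv, rfl⟩ := hC T p hp.le
  refine ⟨v, hv, ?_⟩
  rw [Pi.add_apply, Pi.add_apply, sub_add_cancel_left, norm_neg]
  have hsT : ‖coboundary s T v‖ ≤ ‖s (tmove T v)‖ + ‖s T‖ := norm_sub_le _ _
  linarith [hs₃ T, hs₃ (tmove T v)]

end StrongRepresentative

/-! ### Locality of conjugacies -/

section Locality

variable {d : ℕ} {X X' X₁ X₂ : Type*} [MetricSpace X] [MetricSpace X'] [MetricSpace X₁]
  [MetricSpace X₂] {Ω : TilingSpace d X} {Ω' : TilingSpace d X'} {Ω₁ : TilingSpace d X₁}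
  {Ω₂ : TilingSpace d X₂} [CompactSpace Ω]

theorem IsLocalMap.tmove_of_isStronglyPE {f : Ω → Ω'} (hf : IsLocalMap f) {σ : Ω → E d}
    (hσ : IsStronglyPE σ) : IsLocalMap fun T => tmove (f T) (σ T) := by
  obtain ⟨hσc, B, -, hσB⟩ := hσ
  obtain ⟨hfc, hfloc⟩ := hf
  refine ⟨by fun_prop, fun r hr => ?_⟩
  obtain ⟨L, hL⟩ := (isCompact_range hσc).isBounded.exists_norm_le
  obtain ⟨A, hA, hfA⟩ := hfloc (r + |L|) (by positivity)
  refine ⟨max A B, lt_max_of_lt_left hA, fun T T' hTT' => ?_⟩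
  have hσT : ‖σ T‖ ≤ |L| := (hL _ (mem_range_self T)).trans (le_abs_self L)
  simp only [← hσB T T' (hTT'.mono (le_max_right _ _))]
  exact (hfA T T' (hTT'.mono (le_max_left _ _))).tmove (by linarith)

theorem IsOrbitEquivalence.exists_samePatch_lift {h : Ω ≃ₜ Ω₁} (hh : IsOrbitEquivalence h)
    (hΩ : Ω.FLC) {s : Ω → E d} (hs : Continuous s)
    (hloc : IsLocalMap fun T => tmove (h T) (s T)) (A : ℝ) :
    ∃ R > 0, ∀ T S', SamePatch R (h T) S' →
      ∃ T', SamePatch A T T' ∧ tmove (h T') (s T') = tmove S' (s T) := by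
  have : CompactSpace Ω₁ := h.compactSpace
  obtain ⟨α, hα⟩ := hh.exists_isCocycleOf
  obtain ⟨L, hL⟩ := (isCompact_range hs).isBounded.exists_norm_le
  obtain ⟨r₀, hr₀, R₀, hR₀, hrig⟩ := Ω₁.exists_isRigid
  obtain ⟨B, -, hB⟩ := hloc.2 R₀ hR₀
  obtain ⟨C, -, hC⟩ := Ω.exists_samePatch_imp_mem
    (CompactSpace.uniformContinuous_of_continuous hs (dist_mem_uniformity (half_pos hr₀)))
  obtain ⟨δ, hδ, hαδ⟩ := hα.exists_norm_lt h.continuous (half_pos hr₀)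
  obtain ⟨U, hU, hUz⟩ := hΩ.exists_samePatch_tmove (max A (max B C)) hδ
  obtain ⟨D, hD, hDU⟩ := Ω₁.exists_samePatch_imp_mem
    (CompactSpace.uniformContinuous_of_continuous h.symm.continuous hU)
  refine ⟨max D (L + R₀), lt_max_of_lt_left hD, fun T S' hTS' => ?_⟩
  obtain ⟨z, hz, hTz⟩ : ∃ z, ‖z‖ < δ ∧ SamePatch (max A (max B C)) T (tmove (h.symm S') z) :=
    hUz _ _ (h.symm_apply_apply T ▸ hDU _ _ (hTS'.mono (le_max_left _ _)))
  obtain ⟨hTA, hTB, hTC⟩ : SamePatch A T (tmove (h.symm S') z) ∧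
      SamePatch B T (tmove (h.symm S') z) ∧ SamePatch C T (tmove (h.symm S') z) :=
    ⟨hTz.mono (by simp), hTz.mono (by simp), hTz.mono (by simp)⟩
  refine ⟨_, hTA, ?_⟩
  have hlift : tmove (h (tmove (h.symm S') z)) (s (tmove (h.symm S') z)) =
      tmove S' (α (h.symm S') z + s (tmove (h.symm S') z)) := by
    rw [hα, h.apply_symm_apply, tmove_tmove]
  have hsz : ‖s T - s (tmove (h.symm S') z)‖ < r₀ / 2 :=
    (dist_eq_norm _ _).symm.trans_lt (hC _ _ hTC)
  rw [hlift]
  congr 1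
  refine hrig S' _ _ ?_ ?_
  · rw [← sub_sub_eq_add_sub]
    linarith [norm_sub_le (α (h.symm S') z) (s T - s (tmove (h.symm S') z)), hαδ (h.symm S') z hz]
  · rw [← hlift]
    exact (hB _ _ hTB).symm.trans
      (hTS'.tmove ((add_le_add_left (hL _ (mem_range_self T)) R₀).trans (le_max_right _ _)))

theorem IsConjugacy.isLocalMap_of_tmove {h : Ω ≃ₜ Ω₁} {φ : Ω₁ ≃ₜ Ω₂} (hφ : IsConjugacy φ)
    (hh : IsOrbitEquivalence h) (hΩ : Ω.FLC) {s : Ω → E d} (hs : Continuous s)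
    (hloc : IsLocalMap fun T => tmove (h T) (s T))
    (hφloc : IsLocalMap fun T => φ (tmove (h T) (s T))) : IsLocalMap φ := by
  refine ⟨φ.continuous, fun r hr => ?_⟩
  obtain ⟨L, hL⟩ := (isCompact_range hs).isBounded.exists_norm_le
  obtain ⟨A, -, hA⟩ := hφloc.2 (|L| + r) (by positivity)
  obtain ⟨R, hR, hlift⟩ := hh.exists_samePatch_lift hΩ hs hloc A
  refine ⟨R, hR, fun S S' hSS' => ?_⟩
  obtain ⟨T, rfl⟩ := h.surjective S
  obtain ⟨T', hTT', hT'⟩ := hlift T S' hSS'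
  have hpatch := hA T T' hTT'
  simp only [hT', hφ _ (s T)] at hpatch
  have hsT : ‖-s T‖ ≤ |L| := norm_neg (s T) ▸ (hL _ (mem_range_self T)).trans (le_abs_self L)
  simpa only [tmove_tmove, add_neg_cancel, tmove_zero] using
    hpatch.tmove (v := -s T) (R' := r) (by linarith)

end Locality

/-! ### Equality of classes -/

section Classes

variable {d : ℕ} {X X₁ X₂ : Type*} [MetricSpace X] [MetricSpace X₁] [MetricSpace X₂]
  {Ω : TilingSpace d X} {Ω₁ : TilingSpace d X₁} {Ω₂ : TilingSpace d X₂}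

theorem weakClass_eq_mk {h : Ω → Ω₁} {α : weakCocycles Ω} (hα : IsCocycleOf h α) :
    weakClass h = Submodule.Quotient.mk α := by
  have hex : ∃ α : weakCocycles Ω, IsCocycleOf h α := ⟨α, hα⟩
  rw [weakClass, dif_pos hex, Subtype.ext (hex.choose_spec.unique hα)]

theorem exists_strongClass_eq_mk {h : Ω → Ω₁}
    (hex : ∃ α : strongCocycles Ω, IsStrongRepresentative h α) :
    ∃ α : strongCocycles Ω, IsStrongRepresentative h α ∧
      strongClass h = Submodule.Quotient.mk α :=
  ⟨hex.choose, hex.choose_spec, by rw [strongClass, dif_pos hex]⟩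

variable [CompactSpace Ω] {h₁ : Ω ≃ₜ Ω₁} {h₂ : Ω ≃ₜ Ω₂}

theorem exists_common_isCocycleOf_of_weakClass_eq (hh₁ : IsOrbitEquivalence h₁)
    (hh₂ : IsOrbitEquivalence h₂) (hcls : weakClass h₁ = weakClass h₂) :
    ∃ σ : Ω → E d, Continuous σ ∧ ∃ α, IsCocycleOf h₁ α ∧
      IsCocycleOf (fun T => tmove (h₂ T) (σ T)) α := by
  have : CompactSpace Ω₁ := h₁.compactSpace
  have : CompactSpace Ω₂ := h₂.compactSpace
  obtain ⟨α₁, hα₁⟩ := hh₁.exists_isCocycleOf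
  obtain ⟨α₂, hα₂⟩ := hh₂.exists_isCocycleOf
  rw [weakClass_eq_mk (α := ⟨α₁, hα₁.mem_weakCocycles h₁.continuous⟩) hα₁,
    weakClass_eq_mk (α := ⟨α₂, hα₂.mem_weakCocycles h₂.continuous⟩) hα₂,
    Submodule.Quotient.eq] at hcls
  obtain ⟨σ, hσ, hασ⟩ := hcls
  obtain rfl : α₁ = α₂ + coboundary σ := sub_eq_iff_eq_add'.1 hασ
  exact ⟨σ, hσ, _, hα₁, hα₂.perturb σ⟩

theorem exists_common_isCocycleOf_of_strongClass_eq (hΩ : Ω.FLC) (hΩ₁ : Ω₁.FLC) (hΩ₂ : Ω₂.FLC)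
    (hh₁ : IsOrbitEquivalence h₁) (hh₂ : IsOrbitEquivalence h₂)
    (hcls : strongClass h₁ = strongClass h₂) :
    ∃ s₁ s₂ : Ω → E d, Continuous s₁ ∧ Continuous s₂ ∧
      IsLocalMap (fun T => tmove (h₁ T) (s₁ T)) ∧ IsLocalMap (fun T => tmove (h₂ T) (s₂ T)) ∧
      ∃ α, IsCocycleOf (fun T => tmove (h₁ T) (s₁ T)) α ∧
        IsCocycleOf (fun T => tmove (h₂ T) (s₂ T)) α := by
  have : CompactSpace Ω₁ := h₁.compactSpace
  have : CompactSpace Ω₂ := h₂.compactSpace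
  obtain ⟨⟨γ₁, _⟩, ⟨s₁, hs₁, hloc₁, hγ₁⟩, hcls₁⟩ :=
    exists_strongClass_eq_mk (hh₁.exists_isStrongRepresentative hΩ hΩ₁)
  obtain ⟨⟨γ₂, _⟩, ⟨s₂, hs₂, hloc₂, hγ₂⟩, hcls₂⟩ :=
    exists_strongClass_eq_mk (hh₂.exists_isStrongRepresentative hΩ hΩ₂)
  rw [hcls₁, hcls₂, Submodule.Quotient.eq] at hcls
  obtain ⟨σ, hσ, hγσ⟩ := hcls
  obtain rfl : γ₁ = γ₂ + coboundary σ := sub_eq_iff_eq_add'.1 hγσ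
  have hloc := hloc₂.tmove_of_isStronglyPE hσ
  have hγ := hγ₂.perturb σ
  simp only [tmove_tmove] at hloc hγ
  exact ⟨s₁, s₂ + σ, hs₁, hs₂.add hσ.1, hloc₁, hloc, _, hγ₁, hγ⟩

end Classes

theorem mainTheorem1_general {d : ℕ} {X X₁ X₂ : Type*} [MetricSpace X] [MetricSpace X₁]
    [MetricSpace X₂] (Ω : TilingSpace d X) (Ω₁ : TilingSpace d X₁) (Ω₂ : TilingSpace d X₂)
    [CompactSpace Ω] (h₁ : Ω ≃ₜ Ω₁) (h₂ : Ω ≃ₜ Ω₂)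
    (hh₁ : IsOrbitEquivalence h₁) (hh₂ : IsOrbitEquivalence h₂) :
    (weakClass h₁ = weakClass h₂ →
      ∃ s : Ω → E d, Continuous s ∧ IsHomeomorph (fun T : Ω => tmove T (s T)) ∧
        ∃ φ : Ω₁ ≃ₜ Ω₂, IsConjugacy φ ∧ ∀ T : Ω, h₂ (tmove T (s T)) = φ (h₁ T)) ∧
    (Ω.FLC → Ω₁.FLC → Ω₂.FLC → strongClass h₁ = strongClass h₂ →
      ∃ s : Ω → E d, Continuous s ∧ IsHomeomorph (fun T : Ω => tmove T (s T)) ∧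
        ∃ φ : Ω₁ ≃ₜ Ω₂, IsMLD φ ∧ ∀ T : Ω, h₂ (tmove T (s T)) = φ (h₁ T)) := by
  refine ⟨fun hcls => ?_, fun hΩ hΩ₁ hΩ₂ hcls => ?_⟩
  · obtain ⟨σ, hσ, α, hα₁, hα₂⟩ := exists_common_isCocycleOf_of_weakClass_eq hh₁ hh₂ hcls
    obtain ⟨s, hs, hs', φ, hφ, hφh, -⟩ := exists_isConjugacy_of_isCocycleOf hh₁ hh₂ hα₁ hσ hα₂
    exact ⟨s, hs, hs', φ, hφ, hφh⟩
  · obtain ⟨s₁, s₂, hs₁, hs₂, hloc₁, hloc₂, α, hα₁, hα₂⟩ :=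
      exists_common_isCocycleOf_of_strongClass_eq hΩ hΩ₁ hΩ₂ hh₁ hh₂ hcls
    obtain ⟨s, hs, hs', φ, hφ, hφh, hφs⟩ :=
      exists_isConjugacy_of_common_isCocycleOf hh₁ hh₂ hs₁ hs₂ hα₁ hα₂
    have hφs' : ∀ T, φ.symm (tmove (h₂ T) (s₂ T)) = tmove (h₁ T) (s₁ T) := fun T =>
      φ.symm_apply_eq.2 (hφs T).symm
    refine ⟨s, hs, hs', φ, ⟨hφ, hφ.isLocalMap_of_tmove hh₁ hΩ hs₁ hloc₁ ?_,
      hφ.symm.isLocalMap_of_tmove hh₂ hΩ hs₂ hloc₂ ?_⟩, hφh⟩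
    · simpa only [hφs] using hloc₂
    · simpa only [hφs'] using hloc₁

end TilingClassification

open TilingClassification in
theorem mainTheorem1 {d : ℕ} {X X₁ X₂ : Type*}
    [MetricSpace X] [CompactSpace X] [MetricSpace X₁] [CompactSpace X₁]
    [MetricSpace X₂] [CompactSpace X₂]
    (Ω : TilingSpace d X) (Ω₁ : TilingSpace d X₁) (Ω₂ : TilingSpace d X₂)
    (h₁ : Ω ≃ₜ Ω₁) (h₂ : Ω ≃ₜ Ω₂)
    (hh₁ : IsOrbitEquivalence h₁) (hh₂ : IsOrbitEquivalence h₂) :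
    (weakClass h₁ = weakClass h₂ →
      ∃ s : Ω → E d, Continuous s ∧ IsHomeomorph (fun T : Ω => tmove T (s T)) ∧
        ∃ φ : Ω₁ ≃ₜ Ω₂, IsConjugacy φ ∧ ∀ T : Ω, h₂ (tmove T (s T)) = φ (h₁ T)) ∧
    (Ω.FLC → Ω₁.FLC → Ω₂.FLC → strongClass h₁ = strongClass h₂ →
      ∃ s : Ω → E d, Continuous s ∧ IsHomeomorph (fun T : Ω => tmove T (s T)) ∧
        ∃ φ : Ω₁ ≃ₜ Ω₂, IsMLD φ ∧ ∀ T : Ω, h₂ (tmove T (s T)) = φ (h₁ T)) :=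
  mainTheorem1_general Ω Ω₁ Ω₂ h₁ h₂ hh₁ hh₂
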